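/- Let $D$ be a finitely generated abelian group and let $S=\bigoplus_{d\in D}S_d$ be a $D$-graded commutative ring. The grading defines an action of the diagonalizable group scheme $G=\operatorname{Spec}(S_0[D])$ on $X=\operatorname{Spec}(S)$ over $\operatorname{Spec}(S_0)$, given by the coaction $S\to S_0[D]\otimes_{S_0}S$, $s\mapsto\chi^d\otimes s$ for $s\in S_d$. A homogeneous element $f\in S$ is called \emph{relevant} if the group $D^f\subseteq D$ of degrees of homogeneous units of $S_f$ has finite index in $D$; let $\operatorname{Rel}^D(S)$ be the set of relevant elements and $S_+\unlhd S$ the ideal generated by it. For relevant $f$ let $S_{(f)}$ be the degree-zero part of $S_f$. The scheme $\operatorname{Proj}^D(S)$ is obtained by gluing the affine schemes $D_+(f)=\operatorname{Spec}(S_{(f)})$, $f\in\operatorname{Rel}^D(S)$, along the open subschemes $D_+(fg)$. For $x\in X$ let the orbit cone $\sigma(x)\subseteq D_{\mathbb R}=D\otimes_{\mathbb Z}\mathbb R$ be the closure of the convex cone generated by all $d\in D$ such that $f(x)\neq0$ for some $f\in S_d$. For $d\in D$ let $$X^{\mathrm{ss}}(d)=\{x\in X\mid f(x)\ne0\text{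 for some } n>0 \text{ and } f\in S_{nd}\},\qquad X^{\mathrm{gss}}(d)=\{x\in X^{\mathrm{ss}}(d)\mid \dim\sigma(x)=\operatorname{rank}(D)\},$$ where $\operatorname{rank}(D)$ is the dimension of $G$ relative to $\operatorname{Spec}(S_0)$. Let $X^{\mathrm{gss}}=\bigcup_{d\in D}X^{\mathrm{gss}}(d)$ be the set of geometrically semistable points. Then $$X^{\mathrm{gss}}=\bigcup_{f\in\operatorname{Rel}^D(S)}D(f)=D(S_+):=X\smallsetminus V(S_+).$$ In particular $X^{\mathrm{gss}}$ is open in $X$ and stable under $G$, and $\operatorname{Proj}^D(S)$ is the geometric quotient $X^{\mathrm{gss}}/\!/G$: there is a morphism $\pi\colon X^{\mathrm{gss}}\to\operatorname{Proj}^D(S)$ that restricts to the morphisms $D(f)=\operatorname{Spec}(S_f)\to\operatorname{Spec}(S_{(f)})=D_+(f)$ given by $S_{(f)}\subseteq S_f$ for all relevant $f$, and $\pi$ is a geometric quotient in the sense of Mumford. That is, $\pi$ is $G$-invariant, surjective and submersive, the image of $G\times_{S_0} X^{\mathrm{gss}}\to X^{\mathrm{gss}}\times_{S_0} X^{\mathrm{gss}}$,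 $(g,x)\mapsto(gx,x)$, is $X^{\mathrm{gss}}\times_{\operatorname{Proj}^D(S)}X^{\mathrm{gss}}$, and the structure sheaf of $\operatorname{Proj}^D(S)$ is the sheaf of $G$-invariant functions on $X^{\mathrm{gss}}$. This characterizes $\operatorname{Proj}^D(S)$ without the notion of relevance: for every geometric quotient $\varphi\colon X^{\mathrm{gss}}\to Y$ by $G$ there is a unique isomorphism $e\colon\operatorname{Proj}^D(S)\to Y$ with $e\circ\pi=\varphi$. -/

import Mathlib

open CategoryTheory AlgebraicGeometry MonoidalCategory CartesianMonoidalCategory Limits Opposite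
open scoped TensorProduct MonObj

universe u v₁ v₂ u₁ u₂

noncomputable section

namespace DGraded

section

variable {S D : Type u} [CommRing S] [AddCommGroup D] (𝒜 : D → AddSubgroup S)

/-- The orbit cone `σ(x) ⊆ D_ℝ = ℝ ⊗ D`: the closure, for the usual topology of the finite-dimensional
real vector space `D_ℝ`, of the convex cone generated by the `d ∈ D` for which some `f ∈ S_d`
satisfies `f(x) ≠ 0`. -/
def orbitCone (x : PrimeSpectrum S) : Set (ℝ ⊗[ℤ] D) :=
  letI : TopologicalSpace (ℝ ⊗[ℤ] D) := moduleTopology ℝ (ℝ ⊗[ℤ] D)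
  closure (PointedCone.hull ℝ
    {v : ℝ ⊗[ℤ] D | ∃ d : D, v = 1 ⊗ₜ[ℤ] d ∧ ∃ f ∈ 𝒜 d, f ∉ x.asIdeal} : Set (ℝ ⊗[ℤ] D))

/-- The dimension of the orbit cone `σ(x)`, that is, of the real vector space spanned by it. -/
def orbitConeDim (x : PrimeSpectrum S) : ℕ :=
  Module.finrank ℝ (Submodule.span ℝ (orbitCone 𝒜 x))

/-- The set `X^ss(d)` of semistable points associated to `d ∈ D`. -/
def semistableLocus (d : D) : Set (PrimeSpectrum S) :=
  {x | ∃ n : ℕ, 0 < n ∧ ∃ f ∈ 𝒜 (n • d), f ∉ x.asIdeal}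

/-- The set `X^gss(d)` of geometrically semistable points associated to `d ∈ D`: the semistable points
whose orbit cone has full dimension, namely the rank of `D`, which is the dimension of
`G = Spec S_0[D]` relative to `Spec S_0`. -/
def geometricallySemistableLocusOf (d : D) : Set (PrimeSpectrum S) :=
  {x | x ∈ semistableLocus 𝒜 d ∧ orbitConeDim 𝒜 x = Module.finrank ℤ D}

/-- The set `X^gss` of geometrically semistable points. -/
def geometricallySemistableLocus : Set (PrimeSpectrum S) :=
  ⋃ d : D, geometricallySemistableLocusOf 𝒜 d

end

section
variable {B : Scheme.{u}} (G X : Over B) [GrpObj G] [ModObj G X]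

/-- The action morphism `G × X ⟶ X`. -/
def action : (G ⊗ X).left ⟶ X.left := (γ[G, X] : G ⊗ X ⟶ X).left
/-- The second projection `G × X ⟶ X`. -/
def projection : (G ⊗ X).left ⟶ X.left := (snd G X).left

/-- The open subset `U` of `X` is stable under `G`: the action maps `G × U` to `U`. -/
def IsInvariantOpen (U : X.left.Opens) : Prop :=
  projection G X ⁻¹ᵁ U ≤ action G X ⁻¹ᵁ U

variable {G X} {U : X.left.Opens} (hU : IsInvariantOpen G X U)

/-- The action morphism `G × U ⟶ U` on a `G`-stable open subscheme `U` of `X`; here `G × U` is the open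
subscheme of `G × X` over `U`. -/
def actionOn : (projection G X ⁻¹ᵁ U).toScheme ⟶ U.toScheme :=
  (action G X).resLE U (projection G X ⁻¹ᵁ U) hU

variable (G) (U) in
/-- The second projection `G × U ⟶ U`. -/
def projectionOn : (projection G X ⁻¹ᵁ U).toScheme ⟶ U.toScheme :=
  (projection G X).resLE U (projection G X ⁻¹ᵁ U) le_rfl

/-- The morphism `φ : U ⟶ Y` is a geometric quotient, in the sense of Mumford, of the `G`-stable open
subscheme `U` of `X` by the action of `G`. -/
structure IsGeometricQuotient {Y : Scheme.{u}} (φ : U.toScheme ⟶ Y) : Prop where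
  /-- `φ` is invariant under `G` -/
  invariant : actionOn hU ≫ φ = projectionOn G U ≫ φ
  /-- `φ` is surjective -/
  surjective : Surjective φ
  /-- the image of `G × U ⟶ U × U`, `(g, x) ↦ (g x, x)`, is the fibre product of `U` with itself
  over `Y` -/
  orbits : Surjective (pullback.lift (actionOn hU) (projectionOn G U) invariant)
  /-- `φ` is submersive: `V ⊆ Y` is open if (and only if) its preimage is open -/
  submersive : ∀ V : Set Y, IsOpen (φ ⁻¹' V) → IsOpen V
  /-- the structure sheaf of `Y` is a subsheaf of the direct image of that of `U` ... -/
  app_injective : ∀ V : Y.Opens, Function.Injective (φ.app V)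
  /-- ... and consists of the invariant functions: those whose pullbacks to `G × U` along the action
  and along the projection agree -/
  mem_range_app_iff : ∀ (V : Y.Opens) (s : Γ(U.toScheme, φ ⁻¹ᵁ V)),
    s ∈ Set.range (φ.app V) ↔
      ∀ (W : (projection G X ⁻¹ᵁ U).toScheme.Opens)
        (h₁ : W ≤ actionOn hU ⁻¹ᵁ (φ ⁻¹ᵁ V)) (h₂ : W ≤ projectionOn G U ⁻¹ᵁ (φ ⁻¹ᵁ V)),
        (actionOn hU).appLE (φ ⁻¹ᵁ V) W h₁ s = (projectionOn G U).appLE (φ ⁻¹ᵁ V) W h₂ s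

end

section
variable {C : Type u₁} [Category.{v₁} C] [MonoidalCategory C] {D : Type u₂} [Category.{v₂} D] [MonoidalCategory D]
  (F : C ⥤ D) [F.LaxMonoidal] (M X : C) [MonObj M] [ModObj M X]
open Functor in
/-- A lax monoidal functor sends module objects to module objects. -/
abbrev modObjObj : letI := F.monObjObj M; ModObj (F.obj M) (F.obj X) :=
  letI := F.monObjObj M
  { smul := LaxMonoidal.μ F M X ≫ F.map γ[M, X]
    one_smul := by
      change (LaxMonoidal.ε F ≫ F.map η[M]) ▷ F.obj X ≫ _ = _
      simp [← F.map_comp]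
    mul_smul := by
      change (LaxMonoidal.μ F M M ≫ F.map μ[M]) ▷ F.obj X ≫ LaxMonoidal.μ F M X ≫ F.map γ[M, X] =
        (α_ _ _ _).hom ≫ F.obj M ◁ (LaxMonoidal.μ F M X ≫ F.map γ[M, X]) ≫ LaxMonoidal.μ F M X ≫ F.map γ[M, X]
      simp_rw [MonoidalCategory.comp_whiskerRight, Category.assoc, LaxMonoidal.μ_natural_left_assoc,
        MonoidalCategory.whiskerLeft_comp, Category.assoc, LaxMonoidal.μ_natural_right_assoc,
        ← F.map_comp]
      simp }
end
section
variable {R : CommRingCat.{u}} {A S : Type u} [CommRing A] [Bialgebra R A] [CommRing S]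
  [Algebra R S]

/-- A bialgebra is a monoid object in the opposite category of algebras. -/
instance monOp : MonObj (op (CommAlgCat.of R A)) :=
  ((commBialgCatEquivComonCommAlgCat R).functor.leftOp.obj (.op <| .of R A)).mon

/-- A comodule algebra is a module object in the opposite category of algebras. -/
abbrev modOp (ρ : S →ₐ[R] A ⊗[R] S)
    (counit : (Algebra.TensorProduct.map (Bialgebra.counitAlgHom R A) (AlgHom.id R S)).comp ρ =
      (Algebra.TensorProduct.lid R S).symm.toAlgHom)
    (coassoc : (Algebra.TensorProduct.map (Bialgebra.comulAlgHom R A) (AlgHom.id R S)).comp ρ =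
      (Algebra.TensorProduct.assoc R R R A A S).symm.toAlgHom.comp
        ((Algebra.TensorProduct.map (AlgHom.id R A) ρ).comp ρ)) :
    ModObj (op (CommAlgCat.of R A)) (op (CommAlgCat.of R S)) where
  smul := (CommAlgCat.ofHom ρ).op
  one_smul := Quiver.Hom.unop_inj (CommAlgCat.hom_ext counit)
  mul_smul := Quiver.Hom.unop_inj (CommAlgCat.hom_ext coassoc)

/-- The action of the affine monoid scheme `Spec A` on `Spec S` over `Spec R` given by a coaction
`S → A ⊗ S`. -/
abbrev modObjOfCoaction (ρ : S →ₐ[R] A ⊗[R] S)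
    (counit : (Algebra.TensorProduct.map (Bialgebra.counitAlgHom R A) (AlgHom.id R S)).comp ρ =
      (Algebra.TensorProduct.lid R S).symm.toAlgHom)
    (coassoc : (Algebra.TensorProduct.map (Bialgebra.comulAlgHom R A) (AlgHom.id R S)).comp ρ =
      (Algebra.TensorProduct.assoc R R R A A S).symm.toAlgHom.comp
        ((Algebra.TensorProduct.map (AlgHom.id R A) ρ).comp ρ)) :
    ModObj ((Spec (.of A)).asOver (Spec R)) ((Spec (.of S)).asOver (Spec R)) :=
  letI := modOp ρ counit coassoc
  modObjObj (algSpec R) (op (CommAlgCat.of R A)) (op (CommAlgCat.of R S))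

end
section
variable {S D : Type u} [CommRing S] [AddCommGroup D] [DecidableEq D]
  (𝒜 : D → AddSubgroup S) [GradedRing 𝒜]

/-- The map `S_d → S_0[D] ⊗ S`, `a ↦ χ^d ⊗ a`. -/
def coactionComponent (d : D) : 𝒜 d →+ AddMonoidAlgebra (𝒜 0) D ⊗[𝒜 0] S :=
  (TensorProduct.mk (𝒜 0) (AddMonoidAlgebra (𝒜 0) D) S
    (AddMonoidAlgebra.single d 1)).toAddMonoidHom.comp (𝒜 d).subtype

lemma coactionComponent_apply (d : D) (a : 𝒜 d) :
    coactionComponent 𝒜 d a = AddMonoidAlgebra.single d (1 : 𝒜 0) ⊗ₜ[𝒜 0] (a : S) := rfl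

/-- The ring homomorphism `S → S_0[D] ⊗ S` sending `a ∈ S_d` to `χ^d ⊗ a`. -/
def coactionRingHom : S →+* AddMonoidAlgebra (𝒜 0) D ⊗[𝒜 0] S :=
  (DirectSum.toSemiring (coactionComponent 𝒜)
    (by rw [coactionComponent_apply]; rfl)
    (by
      intro i j a b
      simp only [coactionComponent_apply, Algebra.TensorProduct.tmul_mul_tmul,
        AddMonoidAlgebra.single_mul_single, mul_one]
      rfl)).comp (DirectSum.decomposeRingEquiv 𝒜 : S →+* _)

lemma coactionRingHom_of_mem {d : D} {a : S} (ha : a ∈ 𝒜 d) :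
    coactionRingHom 𝒜 a = AddMonoidAlgebra.single d (1 : 𝒜 0) ⊗ₜ[𝒜 0] a := by
  have h : (DirectSum.decomposeRingEquiv 𝒜) a =
      DirectSum.of (fun i => 𝒜 i) d ⟨a, ha⟩ := DirectSum.decompose_of_mem 𝒜 ha
  rw [coactionRingHom, RingHom.comp_apply, RingHom.coe_coe, h, DirectSum.toSemiring_of,
    coactionComponent_apply]

/-- The coaction `S → S_0[D] ⊗ S` of `S_0[D]` on `S` that is given by the grading: it sends `a ∈ S_d`
to `χ^d ⊗ a`. -/
def coaction : S →ₐ[𝒜 0] AddMonoidAlgebra (𝒜 0) D ⊗[𝒜 0] S where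
  __ := coactionRingHom 𝒜
  commutes' r := (coactionRingHom_of_mem 𝒜 r.2).trans <| by
    rw [Algebra.algebraMap_eq_smul_one, Algebra.TensorProduct.one_def, ← TensorProduct.tmul_smul,
      ← Algebra.algebraMap_eq_smul_one]
    rfl

lemma coaction_of_mem {d : D} {a : S} (ha : a ∈ 𝒜 d) :
    coaction 𝒜 a = AddMonoidAlgebra.single d (1 : 𝒜 0) ⊗ₜ[𝒜 0] a :=
  coactionRingHom_of_mem 𝒜 ha

lemma algHom_ext {B : Type*} [Semiring B] [Algebra (𝒜 0) B] {f g : S →ₐ[𝒜 0] B}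
    (h : ∀ d, ∀ a ∈ 𝒜 d, f a = g a) : f = g := by
  ext a
  induction a using DirectSum.Decomposition.inductionOn 𝒜 with
  | zero => simp
  | homogeneous a => exact h _ _ a.2
  | add a b ha hb => rw [map_add, map_add, ha, hb]

/-- The group scheme `G = Spec S_0[D]` over `Spec S_0`. -/
abbrev torus : Over (Spec (.of (𝒜 0))) :=
  (Spec (.of (AddMonoidAlgebra (𝒜 0) D))).asOver (Spec (.of (𝒜 0)))

/-- The scheme `X = Spec S` over `Spec S_0`. -/
abbrev total : Over (Spec (.of (𝒜 0))) :=
  (Spec (.of S)).asOver (Spec (.of (𝒜 0)))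

/-- The action of `G = Spec S_0[D]` on `X = Spec S` given by the grading. -/
instance : ModObj (torus 𝒜) (total 𝒜) :=
  modObjOfCoaction (R := .of (𝒜 0)) (coaction 𝒜)
    (algHom_ext 𝒜 fun d a ha => by simp [coaction_of_mem 𝒜 ha])
    (algHom_ext 𝒜 fun d a ha => by simp [coaction_of_mem 𝒜 ha])

lemma action_torus_total : action (torus 𝒜) (total 𝒜) =
    (pullbackSpecIso (𝒜 0) (AddMonoidAlgebra (𝒜 0) D) S).hom ≫
      Spec.map (CommRingCat.ofHom (coaction 𝒜 : S →+* _)) := rfl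

end

section

variable {S D : Type u} [CommRing S] [AddCommGroup D] [DecidableEq D]
  (𝒜 : D → AddSubgroup S) [GradedRing 𝒜]

open HomogeneousLocalization

set_option linter.unusedSectionVars false

/-- `x ∈ S_f` is homogeneous of degree `d` for the induced grading of `S_f`: `x = a / f ^ n` with
`f ^ n ∈ S_i` and `a ∈ S_{d + i}`. -/
def IsHomogeneousAway (f : S) (d : D) (x : Localization.Away f) : Prop :=
  ∃ (n : ℕ) (i : D) (a : S), f ^ n ∈ 𝒜 i ∧ a ∈ 𝒜 (d + i) ∧
    x * algebraMap S (Localization.Away f) (f ^ n) = algebraMap S (Localization.Away f) a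

variable {𝒜} in
lemma IsHomogeneousAway.mul {f : S} {d e : D} {x y : Localization.Away f}
    (hx : IsHomogeneousAway 𝒜 f d x) (hy : IsHomogeneousAway 𝒜 f e y) :
    IsHomogeneousAway 𝒜 f (d + e) (x * y) := by
  obtain ⟨n, i, a, hi, ha, h⟩ := hx
  obtain ⟨m, j, b, hj, hb, h'⟩ := hy
  refine ⟨n + m, i + j, a * b, ?_, ?_, ?_⟩
  · rw [pow_add]; exact SetLike.mul_mem_graded hi hj
  · rw [show d + e + (i + j) = d + i + (e + j) by abel]; exact SetLike.mul_mem_graded ha hb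
  · rw [pow_add, map_mul, map_mul, ← h, ← h']; ring

/-- The group `D^f ⊆ D` of degrees of the homogeneous units of `S_f`. -/
def unitDegrees (f : S) : AddSubgroup D where
  carrier := {d | ∃ v : (Localization.Away f)ˣ,
    IsHomogeneousAway 𝒜 f d v ∧ IsHomogeneousAway 𝒜 f (-d) (v⁻¹ : (Localization.Away f)ˣ)}
  zero_mem' := ⟨1, ⟨0, 0, 1, by simpa using SetLike.one_mem_graded 𝒜,
      by simpa using SetLike.one_mem_graded 𝒜, by simp⟩,
    ⟨0, 0, 1, by simpa using SetLike.one_mem_graded 𝒜,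
      by simpa using SetLike.one_mem_graded 𝒜, by simp⟩⟩
  add_mem' := by
    rintro d e ⟨v, hv, hv'⟩ ⟨w, hw, hw'⟩
    refine ⟨v * w, hv.mul hw, ?_⟩
    rw [neg_add, mul_inv, Units.val_mul]
    exact hv'.mul hw'
  neg_mem' := by
    rintro d ⟨v, hv, hv'⟩
    exact ⟨v⁻¹, hv', by rwa [inv_inv, neg_neg]⟩

/-- A homogeneous `f ∈ S` is relevant if `D^f` has finite index in `D`. -/
structure IsRelevant (f : S) : Prop where
  homogeneous : SetLike.IsHomogeneousElem 𝒜 f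
  finiteIndex : (unitDegrees 𝒜 f).FiniteIndex

/-- The irrelevant ideal `S_+`, generated by the relevant elements. -/
def irrelevantIdeal : Ideal S := Ideal.span {f | IsRelevant 𝒜 f}

/-- The canonical map `S_f → S_{fh}`. -/
def awayMapOfMul (f h : S) : Localization.Away f →+* Localization.Away (f * h) :=
  Localization.awayLift (algebraMap S _) f
    (isUnit_of_dvd_unit (map_dvd _ ⟨h, rfl⟩) (IsLocalization.Away.algebraMap_isUnit (f * h)))

lemma awayMapOfMul_algebraMap (f h a : S) :
    awayMapOfMul f h (algebraMap S _ a) = algebraMap S _ a :=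
  IsLocalization.Away.lift_eq f
    (isUnit_of_dvd_unit (map_dvd _ ⟨h, rfl⟩) (IsLocalization.Away.algebraMap_isUnit (f * h))) a

variable {𝒜}

lemma IsHomogeneousAway.map {f h : S} {d e : D} (hh : h ∈ 𝒜 e) {x : Localization.Away f}
    (hx : IsHomogeneousAway 𝒜 f d x) :
    IsHomogeneousAway 𝒜 (f * h) d (awayMapOfMul f h x) := by
  obtain ⟨n, i, a, hi, ha, H⟩ := hx
  refine ⟨n, i + n • e, a * h ^ n, ?_, ?_, ?_⟩
  · rw [mul_pow]; exact SetLike.mul_mem_graded hi (SetLike.pow_mem_graded n hh)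
  · rw [← add_assoc]; exact SetLike.mul_mem_graded ha (SetLike.pow_mem_graded n hh)
  · have := congrArg (awayMapOfMul f h) H
    rw [map_mul, awayMapOfMul_algebraMap, awayMapOfMul_algebraMap] at this
    rw [mul_pow, map_mul, map_mul, ← this, mul_assoc]

lemma unitDegrees_le_mul {f h : S} (hh : SetLike.IsHomogeneousElem 𝒜 h) :
    unitDegrees 𝒜 f ≤ unitDegrees 𝒜 (f * h) := by
  obtain ⟨e, hh⟩ := hh
  rintro d ⟨v, hv, hv'⟩
  exact ⟨Units.map (awayMapOfMul f h).toMonoidHom v, hv.map hh, hv'.map hh⟩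

lemma IsRelevant.mul {f h : S} (hf : IsRelevant 𝒜 f) (hh : SetLike.IsHomogeneousElem 𝒜 h) :
    IsRelevant 𝒜 (f * h) where
  homogeneous := hf.homogeneous.mul hh
  finiteIndex :=
    have := hf.finiteIndex
    AddSubgroup.finiteIndex_of_le (unitDegrees_le_mul hh)

/-- `t ∈ S_(f)` is of the form `h ^ N / v`, with `h` homogeneous and `v` a homogeneous unit of `S_f`
of the same degree as `h ^ N`. -/
def IsFraction (𝒜 : D → AddSubgroup S) [GradedRing 𝒜] (f h : S) (N : ℕ)
    (t : Away 𝒜 f) : Prop :=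
  ∃ (e : D) (v : (Localization.Away f)ˣ), h ∈ 𝒜 e ∧ IsHomogeneousAway 𝒜 f (N • e) v ∧
    IsHomogeneousAway 𝒜 f (-(N • e)) (v⁻¹ : (Localization.Away f)ˣ) ∧
    t.val = algebraMap S _ (h ^ N) * (v⁻¹ : (Localization.Away f)ˣ)

lemma IsHomogeneousAway.pow {f : S} {d : D} {x : Localization.Away f}
    (hx : IsHomogeneousAway 𝒜 f d x) (n : ℕ) : IsHomogeneousAway 𝒜 f (n • d) (x ^ n) := by
  induction n with
  | zero =>
    exact ⟨0, 0, 1, by simpa using SetLike.one_mem_graded 𝒜,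
      by simpa using SetLike.one_mem_graded 𝒜, by simp⟩
  | succ n ih => rw [succ_nsmul, pow_succ]; exact ih.mul hx

lemma exists_val_eq {f : S} {x : Localization.Away f} (hx : IsHomogeneousAway 𝒜 f 0 x) :
    ∃ t : Away 𝒜 f, t.val = x := by
  obtain ⟨n, i, a, hi, ha, H⟩ := hx
  rw [zero_add] at ha
  refine ⟨HomogeneousLocalization.mk ⟨i, ⟨a, ha⟩, ⟨f ^ n, hi⟩, ⟨n, rfl⟩⟩, ?_⟩
  rw [HomogeneousLocalization.val_mk, Localization.mk_eq_mk', IsLocalization.mk'_eq_iff_eq_mul]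
  exact H.symm

lemma isHomogeneousAway_algebraMap {f h : S} {e : D} (hh : h ∈ 𝒜 e) :
    IsHomogeneousAway 𝒜 f e (algebraMap S _ h) :=
  ⟨0, 0, h, by simpa using SetLike.one_mem_graded 𝒜, by simpa using hh, by simp⟩

lemma IsRelevant.exists_isFraction {f h : S} (_hf : IsRelevant 𝒜 f)
    (hh : SetLike.IsHomogeneousElem 𝒜 h) :
    ∃ t : Away 𝒜 f, IsFraction 𝒜 f h (unitDegrees 𝒜 f).index t := by
  obtain ⟨e, hh⟩ := hh
  obtain ⟨v, hv, hv'⟩ := (unitDegrees 𝒜 f).nsmul_index_mem e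
  obtain ⟨t, ht⟩ := exists_val_eq (𝒜 := 𝒜) (f := f)
    (x := algebraMap S _ (h ^ (unitDegrees 𝒜 f).index) * (v⁻¹ : (Localization.Away f)ˣ)) (by
      rw [← add_neg_cancel ((unitDegrees 𝒜 f).index • e)]
      exact (isHomogeneousAway_algebraMap (SetLike.pow_mem_graded _ hh)).mul hv')
  exact ⟨t, e, v, hh, hv, hv', ht⟩

lemma IsFraction.mul {f h h' : S} {N : ℕ} {t t' : Away 𝒜 f} (ht : IsFraction 𝒜 f h N t)
    (ht' : IsFraction 𝒜 f h' N t') : IsFraction 𝒜 f (h * h') N (t * t') := by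
  obtain ⟨e, v, hh, hv, hvi, H⟩ := ht
  obtain ⟨e', v', hh', hv', hvi', H'⟩ := ht'
  refine ⟨e + e', v * v', SetLike.mul_mem_graded hh hh', ?_, ?_, ?_⟩
  · rw [smul_add]; exact hv.mul hv'
  · rw [smul_add, neg_add, mul_inv]; exact hvi.mul hvi'
  · rw [val_mul, H, H', mul_pow, map_mul, mul_inv, Units.val_mul]; ring

lemma val_awayMap_eq {f h : S} {e : D} (hh : h ∈ 𝒜 e) (y : Away 𝒜 f) :
    (awayMap 𝒜 hh rfl y).val = awayMapOfMul f h y.val :=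
  val_awayMap 𝒜 hh rfl y

lemma isHomogeneousAway_val {f : S} (y : Away 𝒜 f) : IsHomogeneousAway 𝒜 f 0 y.val := by
  obtain ⟨⟨i, a, b, n, hb⟩, rfl⟩ := HomogeneousLocalization.mk_surjective y
  have hb' : f ^ n = b := hb
  refine ⟨n, i, a, hb' ▸ b.2, by simp, ?_⟩
  rw [HomogeneousLocalization.val_mk, Localization.mk_eq_mk', hb']
  exact IsLocalization.mk'_spec _ _ _

lemma awayMapOfMul_isUnit (f h : S) :
    IsUnit (algebraMap S (Localization.Away (f * h)) f) ∧
      IsUnit (algebraMap S (Localization.Away (f * h)) h) := by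
  have := IsLocalization.Away.algebraMap_isUnit (S := Localization.Away (f * h)) (f * h)
  rw [map_mul] at this
  exact ⟨isUnit_of_mul_isUnit_left this, isUnit_of_mul_isUnit_right this⟩

/-- `S_{(fh)}` is the localization of `S_{(f)}` at `t = h ^ N / v`. -/
lemma IsFraction.isLocalization {f h : S} {N : ℕ} (hf : SetLike.IsHomogeneousElem 𝒜 f)
    (hN : N ≠ 0) {t : Away 𝒜 f}
    (ht : IsFraction 𝒜 f h N t) {e' : D} (hh' : h ∈ 𝒜 e') :
    letI := (awayMap 𝒜 hh' (rfl : f * h = f * h)).toAlgebra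
    IsLocalization.Away t (Away 𝒜 (f * h)) := by
  let := (awayMap 𝒜 hh' (rfl : f * h = f * h)).toAlgebra
  obtain ⟨i, hf⟩ := hf
  obtain ⟨e, v, hh, hv, hvi, H⟩ := ht
  have halg (y : Away 𝒜 f) : (algebraMap _ (Away 𝒜 (f * h)) y).val = awayMapOfMul f h y.val :=
    val_awayMap_eq hh' y
  obtain ⟨huf, huh⟩ := awayMapOfMul_isUnit f h
  have hti : awayMapOfMul f h t.val =
      algebraMap S _ h ^ N * awayMapOfMul f h (v⁻¹ : (Localization.Away f)ˣ) := by
    rw [H, map_mul, awayMapOfMul_algebraMap, map_pow]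
  have hvv : awayMapOfMul f h (v : Localization.Away f) *
      awayMapOfMul f h (v⁻¹ : (Localization.Away f)ˣ) = 1 := by
    rw [← map_mul, Units.mul_inv, map_one]
  -- the inverse of `h` is homogeneous in the localization at `f * h`
  have hhi : IsHomogeneousAway 𝒜 (f * h) (-e) (huh.unit⁻¹ : (Localization.Away (f * h))ˣ) := by
    refine ⟨1, i + e, f, by rw [pow_one]; exact SetLike.mul_mem_graded hf hh, by
      rwa [show -e + (i + e) = i by abel], ?_⟩
    rw [pow_one, map_mul, mul_left_comm]
    simp
  have hvi' := hvi.map (h := h) hh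
  constructor; constructor
  · rintro ⟨_, n, rfl⟩
    refine IsUnit.pow n ?_ |> fun h => by simpa using h
    obtain ⟨s, hs⟩ := exists_val_eq (𝒜 := 𝒜) (f := f * h)
      (x := awayMapOfMul f h (v : Localization.Away f) *
        (huh.unit⁻¹ : (Localization.Away (f * h))ˣ) ^ N) (by
        have := (hv.map (h := h) hh).mul (hhi.pow N)
        rwa [smul_neg, add_neg_cancel] at this)
    refine .of_mul_eq_one s (HomogeneousLocalization.val_injective _ ?_)
    rw [val_mul, val_one, halg, hti, hs]
    have h1 : algebraMap S (Localization.Away (f * h)) h *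
        (huh.unit⁻¹ : (Localization.Away (f * h))ˣ) = 1 := huh.mul_val_inv
    calc _ = (algebraMap S (Localization.Away (f * h)) h *
        (huh.unit⁻¹ : (Localization.Away (f * h))ˣ)) ^ N *
        (awayMapOfMul f h (v : Localization.Away f) *
          awayMapOfMul f h (v⁻¹ : (Localization.Away f)ˣ)) := by ring
      _ = 1 := by rw [h1, hvv, one_pow, one_mul]
  · intro z
    obtain ⟨n, s, hs, rfl⟩ := Away.mk_surjective 𝒜 (SetLike.mul_mem_graded hf hh) z
    have huf' : IsUnit (algebraMap S (Localization.Away f) f) :=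
      IsLocalization.Away.algebraMap_isUnit f
    have hfi : IsHomogeneousAway 𝒜 f (-i) (huf'.unit⁻¹ : (Localization.Away f)ˣ) :=
      ⟨1, i, 1, by rwa [pow_one], by simpa using SetLike.one_mem_graded 𝒜, by simp⟩
    obtain ⟨k, rfl⟩ := Nat.exists_eq_add_one_of_ne_zero hN
    obtain ⟨y, hy⟩ := exists_val_eq (𝒜 := 𝒜) (f := f)
      (x := algebraMap S _ (s * h ^ (n * k)) * (v⁻¹ : (Localization.Away f)ˣ) ^ n *
        (huf'.unit⁻¹ : (Localization.Away f)ˣ) ^ n) (by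
        have := ((isHomogeneousAway_algebraMap (f := f) (SetLike.mul_mem_graded hs
          (SetLike.pow_mem_graded (n * k) hh))).mul (hvi.pow n)).mul (hfi.pow n)
        convert this using 1
        simp only [smul_add, smul_neg, add_smul, one_smul, mul_smul]
        abel)
    refine ⟨⟨y, ⟨_, n, rfl⟩⟩, HomogeneousLocalization.val_injective _ ?_⟩
    have h1 : awayMapOfMul f h (huf'.unit⁻¹ : (Localization.Away f)ˣ) *
        algebraMap S (Localization.Away (f * h)) f = 1 := by
      rw [← awayMapOfMul_algebraMap, ← map_mul, huf'.val_inv_mul, map_one]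
    have h2 : (Away.mk 𝒜 (SetLike.mul_mem_graded hf hh) n s hs).val *
        algebraMap S (Localization.Away (f * h)) ((f * h) ^ n) = algebraMap S _ s := by
      rw [Away.val_mk, Localization.mk_eq_mk']
      exact IsLocalization.mk'_spec _ _ _
    rw [val_mul, map_pow, val_pow, halg, hti, halg, hy]
    simp only [map_mul, map_pow, awayMapOfMul_algebraMap] at h2 ⊢
    rw [← h2]
    have h3 := congrArg (· ^ n) h1
    simp only [mul_pow, one_pow] at h3
    linear_combination (-(Away.mk 𝒜 (SetLike.mul_mem_graded hf hh) n s hs).val *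
      algebraMap S _ h ^ (n + n * k) *
      awayMapOfMul f h (v⁻¹ : (Localization.Away f)ˣ) ^ n) * h3
  · intro a b hab
    have hab' := congrArg HomogeneousLocalization.val hab
    rw [halg, halg, ← sub_eq_zero, ← map_sub] at hab'
    obtain ⟨⟨p, ⟨_, n, rfl⟩⟩, hp⟩ := IsLocalization.surj (Submonoid.powers f) (a.val - b.val)
    have hp0 := congrArg (awayMapOfMul f h) hp
    rw [map_mul, hab', zero_mul, awayMapOfMul_algebraMap] at hp0
    obtain ⟨⟨_, k, rfl⟩, hk⟩ := (IsLocalization.map_eq_zero_iff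
      (Submonoid.powers (f * h)) (Localization.Away (f * h)) p).mp hp0.symm
    refine ⟨⟨_, k, rfl⟩, HomogeneousLocalization.val_injective _ ?_⟩
    have huf' : IsUnit (algebraMap S (Localization.Away f) f) :=
      IsLocalization.Away.algebraMap_isUnit f
    have hk' := congrArg (algebraMap S (Localization.Away f)) hk
    simp only [map_mul, map_pow, map_zero, mul_pow] at hk' hp
    have h0 : algebraMap S (Localization.Away f) h ^ k * (a.val - b.val) = 0 := by
      refine (huf'.pow (k + n)).mul_left_cancel ?_
      rw [mul_zero, ← hk', ← hp]
      ring
    obtain ⟨N, rfl⟩ := Nat.exists_eq_add_one_of_ne_zero hN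
    simp only [val_mul, val_pow, H, map_pow]
    linear_combination (algebraMap S (Localization.Away f) h ^ (k * N) *
      (v⁻¹ : (Localization.Away f)ˣ) ^ k) * h0

variable (𝒜) in
/-- The relevant elements of `S`, ordered in such a way that `f ≤ g` if `f` is a homogeneous multiple
of `g`; then `D_+(f) ⊆ D_+(g)`. -/
structure RelevantElement where
  val : S
  isRelevant : IsRelevant 𝒜 val

instance : Preorder (RelevantElement 𝒜) where
  le f g := ∃ h, SetLike.IsHomogeneousElem 𝒜 h ∧ f.val = g.val * h
  le_refl f := ⟨1, ⟨0, SetLike.one_mem_graded 𝒜⟩, (mul_one _).symm⟩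
  le_trans := by
    rintro a b c ⟨h, hh, e⟩ ⟨h', hh', e'⟩
    exact ⟨h' * h, hh'.mul hh, by rw [e, e', mul_assoc]⟩

/-- The canonical map `S_(g) → S_(f)` for `f ≤ g`, that is, for `g` dividing `f`. -/
def chartMap {f g : RelevantElement 𝒜} (h : f ≤ g) : Away 𝒜 g.val →+* Away 𝒜 f.val :=
  awayMap 𝒜 h.choose_spec.1.choose_spec h.choose_spec.2

lemma val_chartMap_algebraMap {f g : RelevantElement 𝒜} (h : f ≤ g) (y : Away 𝒜 g.val) :
   (chartMap h y).val = Localization.awayLift (algebraMap S _) g.val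
    (isUnit_of_dvd_unit (map_dvd _ ⟨_, h.choose_spec.2⟩)
      (IsLocalization.Away.algebraMap_isUnit f.val)) y.val := val_awayMap ..

lemma chartMap_refl (f : RelevantElement 𝒜) : chartMap (le_refl f) = RingHom.id _ := by
  ext y
  rw [val_chartMap_algebraMap]
  refine DFunLike.congr_fun (?_ : _ = RingHom.id _) y.val
  refine IsLocalization.ringHom_ext (Submonoid.powers f.val) ?_
  ext a
  simp [Localization.awayLift]

lemma chartMap_trans {f g k : RelevantElement 𝒜} (h : f ≤ g) (h' : g ≤ k) :
    chartMap (h.trans h') = (chartMap h).comp (chartMap h') := by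
  ext y
  rw [RingHom.comp_apply, val_chartMap_algebraMap, val_chartMap_algebraMap,
    val_chartMap_algebraMap, ← RingHom.comp_apply]
  refine DFunLike.congr_fun ?_ y.val
  refine IsLocalization.ringHom_ext (Submonoid.powers k.val) ?_
  ext a
  simp [Localization.awayLift]

lemma chartMap_eq_awayMap {f g : RelevantElement 𝒜} (h : f ≤ g) {e : D} {x : S} (hx : x ∈ 𝒜 e)
    (he : f.val = g.val * x) : chartMap h = awayMap 𝒜 hx he := by
  ext y
  rw [val_chartMap_algebraMap, val_awayMap]

variable (𝒜) in
/-- The diagram of the affine schemes `D_+(f) = Spec S_(f)`, for `f` relevant, and the open immersions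
`D_+(f) ⊆ D_+(g)` for `f ≤ g`. -/
def chartFunctor : RelevantElement 𝒜 ⥤ Scheme.{u} where
  obj f := Spec (.of (Away 𝒜 f.val))
  map h := Spec.map (CommRingCat.ofHom (chartMap h.le))
  map_id f := by rw [chartMap_refl]; exact Spec.map_id _
  map_comp h h' := by
    rw [chartMap_trans, CommRingCat.ofHom_comp, Spec.map_comp]

lemma exists_isLocalization {f g : RelevantElement 𝒜} (h : f ≤ g) {x : S}
    (hx : SetLike.IsHomogeneousElem 𝒜 x) (he : f.val = g.val * x)
    {t : Away 𝒜 g.val} (ht : IsFraction 𝒜 g.val x (unitDegrees 𝒜 g.val).index t) :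
    letI := (chartMap h).toAlgebra
    IsLocalization.Away t (Away 𝒜 f.val) := by
  obtain ⟨f, hf⟩ := f
  obtain ⟨e, hx'⟩ := hx
  dsimp only at he
  subst he
  rw [chartMap_eq_awayMap h hx' rfl]
  exact ht.isLocalization g.isRelevant.homogeneous g.isRelevant.finiteIndex.index_ne_zero hx'

instance {f g : RelevantElement 𝒜} (h : f ⟶ g) : IsOpenImmersion ((chartFunctor 𝒜).map h) := by
  obtain ⟨x, hx, he⟩ := h.le
  obtain ⟨t, ht⟩ := g.isRelevant.exists_isFraction hx
  let := (chartMap h.le).toAlgebra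
  have := exists_isLocalization h.le hx he ht
  exact IsOpenImmersion.of_isLocalization t

lemma range_chartFunctor_map {f g : RelevantElement 𝒜} (h : f ⟶ g) {x : S}
    (hx : SetLike.IsHomogeneousElem 𝒜 x) (he : f.val = g.val * x)
    {t : Away 𝒜 g.val} (ht : IsFraction 𝒜 g.val x (unitDegrees 𝒜 g.val).index t) :
    Set.range ((chartFunctor 𝒜).map h) = (PrimeSpectrum.basicOpen t : Set (PrimeSpectrum (Away 𝒜 g.val))) := by
  let := (chartMap h.le).toAlgebra
  have := exists_isLocalization h.le hx he ht
  exact PrimeSpectrum.localization_away_comap_range (Away 𝒜 f.val) t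

instance : (chartFunctor 𝒜 ⋙ Scheme.forget).IsLocallyDirected where
  cond {f f' g} i i' p p' hp := by
    obtain ⟨x, hx, he⟩ := i.le
    obtain ⟨x', hx', he'⟩ := i'.le
    obtain ⟨t, ht⟩ := g.isRelevant.exists_isFraction hx
    obtain ⟨t', ht'⟩ := g.isRelevant.exists_isFraction hx'
    let k : RelevantElement 𝒜 := ⟨g.val * (x * x'), g.isRelevant.mul (hx.mul hx')⟩
    have hkf : k ≤ f := ⟨x', hx', by rw [he, mul_assoc]⟩
    have hkf' : k ≤ f' := ⟨x, hx, by rw [he', mul_assoc, mul_comm x']⟩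
    have hkg : k ≤ g := ⟨x * x', hx.mul hx', rfl⟩
    have hr : (chartFunctor 𝒜).map i p ∈ Set.range ((chartFunctor 𝒜).map (homOfLE hkg)) := by
      rw [range_chartFunctor_map (homOfLE hkg) (hx.mul hx') rfl (ht.mul ht'),
        PrimeSpectrum.basicOpen_mul]
      constructor
      · have : (chartFunctor 𝒜).map i p ∈ Set.range ((chartFunctor 𝒜).map i) := ⟨p, rfl⟩
        rwa [range_chartFunctor_map i hx he ht] at this
      · have : (chartFunctor 𝒜).map i p ∈ Set.range ((chartFunctor 𝒜).map i') := ⟨p', hp.symm⟩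
        rwa [range_chartFunctor_map i' hx' he' ht'] at this
    obtain ⟨q, hq⟩ := hr
    refine ⟨k, homOfLE hkf, homOfLE hkf', q, ?_, ?_⟩
    · apply ((chartFunctor 𝒜).map i).isOpenEmbedding.injective
      change ((chartFunctor 𝒜).map (homOfLE hkf) ≫ (chartFunctor 𝒜).map i) q = _
      rw [← Functor.map_comp, ← hq]
      rfl
    · apply ((chartFunctor 𝒜).map i').isOpenEmbedding.injective
      change ((chartFunctor 𝒜).map (homOfLE hkf') ≫ (chartFunctor 𝒜).map i') q = _
      rw [← Functor.map_comp]
      exact hq.trans hp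

variable (𝒜) in
/-- `Proj^D(S)`: the scheme glued from the affine schemes `D_+(f) = Spec S_(f)`, for `f` relevant,
along their open subschemes `D_+(fg) = Spec S_(fg)`. -/
def Proj : Scheme.{u} := colimit (chartFunctor 𝒜)

/-- The inclusion of the chart `D_+(f) = Spec S_(f)` in `Proj^D(S)`. -/
def Proj.ι (f : RelevantElement 𝒜) : Spec (.of (Away 𝒜 f.val)) ⟶ Proj 𝒜 :=
  colimit.ι (chartFunctor 𝒜) f

variable (𝒜) in
/-- `π : U ⟶ Proj^D(S)`, for an open subscheme `U` of `X = Spec S`, restricts for every relevant `f`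
with `D(f) ⊆ U` to the morphism `D(f) = Spec S_f ⟶ Spec S_(f) = D_+(f)` given by the inclusion of
`S_(f)` in `S_f`. -/
def IsCanonicalProjection (U : (total 𝒜).left.Opens) (π : U.toScheme ⟶ Proj 𝒜) : Prop :=
  ∀ (f : RelevantElement 𝒜) (j : Spec (.of (Localization.Away f.val)) ⟶ U.toScheme),
    j ≫ U.ι = Spec.map (CommRingCat.ofHom (algebraMap S (Localization.Away f.val))) →
      j ≫ π = Spec.map (CommRingCat.ofHom
        (algebraMap (Away 𝒜 f.val) (Localization.Away f.val))) ≫ Proj.ι f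

end

end DGraded

end

/-! The set-theoretic part is about weights. The dimension of `σ(x)` is that of the real span of the
degrees `d` for which some element of `S_d` does not vanish at `x`. If `f` is relevant and `f(x) ≠
0`, every degree in `D^f` is a difference of two such weights, so the weights span `D_ℝ`. If they
span, finitely many weights generate the same subgroup; the product of elements of these degrees
that do not vanish at `x` is relevant, because its factors become homogeneous units.

The quotient is studied on the charts `Spec A → Spec A_0` with `A = S_f`. Projection to degree zero
is an `A_0`-linear retraction of `A_0 ⊆ A`. It makes the chart map surjective and lets
specializations lift, whence submersive (`isOpen_of_isOpen_preimage_comap`). The coaction sends a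
homogeneous `a` of degree `d` to `χ^d ⊗ a`, so the invariants are exactly `A_0`
(`mem_range_of_coactionAway_eq`).

Relevance enters in the description of the fibres. Let two points of `A` with values in an
algebraically closed field `K` agree on `A_0`. Since some power of each homogeneous element is, up
to a homogeneous unit, of degree zero, both points are nonzero on the same homogeneous elements.
Their ratio depends only on the degree and is a character of a subgroup of `D`; it extends to `D`
because `Kˣ` is divisible. So the two points differ by a point of `G`
(`exists_character_of_eq_on_gradeZero`).

The chart statements globalize because the preimage of `D_+(f)` is `D(f)`
(`quotientMap_mem_range_ι_iff`) and the `D_+(f)` form a basis. Finally, a geometric quotient is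
shown to be categorical, which gives the uniqueness. -/

namespace DGraded

/-! ### Spans in `ℝ ⊗ D` and subgroups of finite index -/

section

/-- The real span of the image of a subset generating a subgroup of finite index is everything. -/
lemma span_tmul_eq_top_of_finiteIndex {D : Type*} [AddCommGroup D] (H : AddSubgroup D)
    [H.FiniteIndex] (W : Submodule ℝ (ℝ ⊗[ℤ] D)) (hW : ∀ d ∈ H, (1 : ℝ) ⊗ₜ[ℤ] d ∈ W) : W = ⊤ := by
  rw [eq_top_iff]
  rintro x -
  induction x using TensorProduct.induction_on with
  | zero => exact zero_mem _
  | add x y hx hy => exact add_mem hx hy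
  | tmul r d =>
    -- With `N` the index, `r ⊗ d = (r / N) • (1 ⊗ N d)` and `N d ∈ H`.
    have h := W.smul_mem (r / H.index) (hW _ (H.nsmul_index_mem d))
    have hN : (H.index : ℝ) ≠ 0 := Nat.cast_ne_zero.mpr AddSubgroup.FiniteIndex.index_ne_zero
    rw [TensorProduct.tmul_smul, TensorProduct.smul_tmul', TensorProduct.smul_tmul'] at h
    convert h using 2
    simp [hN]

lemma finrank_real_tensor (D : Type*) [AddCommGroup D] :
    Module.finrank ℝ (ℝ ⊗[ℤ] D) = Module.finrank ℤ D :=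
  (TensorProduct.isBaseChange ℤ D ℝ).finrank_eq

/-- A subgroup whose image spans `ℝ ⊗ D` has finite index. -/
lemma finiteIndex_of_span_tmul_eq_top {D : Type*} [AddCommGroup D] [AddGroup.FG D]
    (H : AddSubgroup D)
    (hH : Submodule.span ℝ {v : ℝ ⊗[ℤ] D | ∃ d ∈ H, v = 1 ⊗ₜ[ℤ] d} = ⊤) : H.FiniteIndex := by
  have : Module.Finite ℤ D := Module.Finite.iff_addGroup_fg.mpr inferInstance
  let N : Submodule ℤ D := AddSubgroup.toIntSubmodule H
  -- `q` is surjective and kills a spanning set, so `ℝ ⊗ (D / H) = 0`: the finitely generated group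
  -- `D / H` is torsion, hence finite.
  let q : ℝ ⊗[ℤ] D →ₗ[ℝ] ℝ ⊗[ℤ] (D ⧸ N) := N.mkQ.baseChange ℝ
  have hq : Function.Surjective q := LinearMap.lTensor_surjective ℝ N.mkQ_surjective
  have h0 : q = 0 := by
    refine LinearMap.ext_on hH ?_
    rintro _ ⟨d, hd, rfl⟩
    have : N.mkQ d = 0 := (Submodule.Quotient.mk_eq_zero N).mpr hd
    simp only [q, LinearMap.baseChange_tmul, this, TensorProduct.tmul_zero, LinearMap.zero_apply]
  have : Subsingleton (ℝ ⊗[ℤ] (D ⧸ N)) := subsingleton_of_forall_eq 0 fun y => by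
    obtain ⟨x, rfl⟩ := hq y
    rw [h0, LinearMap.zero_apply]
  have hr : Module.finrank ℤ (D ⧸ N) = 0 := by
    rw [← finrank_real_tensor, Module.finrank_zero_of_subsingleton]
  have := Module.finite_of_fg_torsion _ (Module.finrank_eq_zero_iff_isTorsion.mp hr)
  have : Finite (D ⧸ H) := this
  exact AddSubgroup.finiteIndex_of_finite_quotient

/-- A spanning set of the span of the closure of a subset of a finite-dimensional space. -/
lemma span_eq_top_of_span_closure_eq_top {V : Type*} [AddCommGroup V] [Module ℝ V]
    [TopologicalSpace V] [IsModuleTopology ℝ V] {s : Set V}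
    (h : Submodule.span ℝ (closure s) = ⊤) : Submodule.span ℝ s = ⊤ := by
  by_contra hs
  -- A proper subspace lies in the kernel of a nonzero functional. This kernel is closed, because
  -- linear maps are continuous for the module topology, so it contains the closure too.
  obtain ⟨φ, hφ, hle⟩ := Submodule.exists_le_ker_of_lt_top _ (lt_top_iff_ne_top.mpr hs)
  have : ContinuousAdd V := IsModuleTopology.toContinuousAdd ℝ V
  have hc : Continuous φ := IsModuleTopology.continuous_of_linearMap φ
  have hcl : closure s ⊆ (LinearMap.ker φ : Set V) :=
    closure_minimal (Submodule.subset_span.trans hle) (isClosed_singleton.preimage hc)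
  refine hφ (LinearMap.ker_eq_top.mp ?_)
  rw [eq_top_iff, ← h]
  exact Submodule.span_le.mpr hcl

end

/-! ### Geometrically semistable points and relevant elements -/

section

variable {S D : Type u} [CommRing S] [AddCommGroup D] [AddGroup.FG D] (𝒜 : D → AddSubgroup S)

/-- Neither positive combinations nor the closure enlarge the linear span, so full dimension of the
cone depends on the weights alone. -/
lemma orbitConeDim_eq_iff (x : PrimeSpectrum S) :
    orbitConeDim 𝒜 x = Module.finrank ℤ D ↔
      Submodule.span ℝ {v : ℝ ⊗[ℤ] D | ∃ d : D, v = 1 ⊗ₜ[ℤ] d ∧ ∃ f ∈ 𝒜 d, f ∉ x.asIdeal} = ⊤ := by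
  have : Module.Finite ℤ D := Module.Finite.iff_addGroup_fg.mpr inferInstance
  let : TopologicalSpace (ℝ ⊗[ℤ] D) := moduleTopology ℝ (ℝ ⊗[ℤ] D)
  have : IsModuleTopology ℝ (ℝ ⊗[ℤ] D) := ⟨rfl⟩
  rw [orbitConeDim, ← finrank_real_tensor]
  constructor
  · intro h
    have h' := span_eq_top_of_span_closure_eq_top (Submodule.eq_top_of_finrank_eq h)
    rw [eq_top_iff, ← h', Submodule.span_le]
    intro v hv
    exact Submodule.span_le_restrictScalars {c : ℝ // 0 ≤ c} ℝ _ hv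
  · intro h
    rw [show Submodule.span ℝ (orbitCone 𝒜 x) = ⊤ from ?_, finrank_top]
    rw [eq_top_iff, ← h]
    exact Submodule.span_mono (Submodule.subset_span.trans subset_closure)

variable [DecidableEq D] [GradedRing 𝒜]

/-- An element that becomes invertible in `S_f` divides a power of `f`. -/
lemma isUnit_algebraMap_notMem {f a : S} {x : PrimeSpectrum S} (hf : f ∉ x.asIdeal)
    (ha : IsUnit (algebraMap S (Localization.Away f) a)) : a ∉ x.asIdeal := by
  intro hax
  obtain ⟨b, hb⟩ := ha.exists_right_inv
  obtain ⟨n, c, hc⟩ := IsLocalization.Away.surj f b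
  have h1 : algebraMap S (Localization.Away f) (f ^ n) =
      algebraMap S (Localization.Away f) (a * c) := by
    rw [map_mul, ← hc, ← mul_assoc, hb, one_mul, map_pow]
  obtain ⟨⟨_, k, rfl⟩, hk⟩ := (IsLocalization.eq_iff_exists (.powers f) _).mp h1
  have : f ^ k * f ^ n ∈ x.asIdeal := by
    rw [hk]
    exact Ideal.mul_mem_left _ _ (Ideal.mul_mem_right _ _ hax)
  rw [← pow_add] at this
  exact hf (x.2.mem_of_pow_mem _ this)

/-- A homogeneous unit of degree `d` is `a / f ^ n` with `a` of degree `d + i` and `f ^ n` of degree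
`i`. Neither vanishes at `x`, so `d = (d + i) - i` is a difference of weights. -/
lemma mem_geometricallySemistableLocus_of_isRelevant {f : S} (hf : IsRelevant 𝒜 f)
    {x : PrimeSpectrum S} (hx : f ∉ x.asIdeal) : x ∈ geometricallySemistableLocus 𝒜 := by
  obtain ⟨e, he⟩ := hf.homogeneous
  refine Set.mem_iUnion.mpr ⟨e, ⟨1, one_pos, f, by rwa [one_smul], hx⟩, ?_⟩
  have := hf.finiteIndex
  rw [orbitConeDim_eq_iff]
  refine span_tmul_eq_top_of_finiteIndex (unitDegrees 𝒜 f) _ ?_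
  rintro d ⟨v, ⟨n, i, a, hi, ha, h⟩, -⟩
  have hfu : IsUnit (algebraMap S (Localization.Away f) (f ^ n)) := by
    rw [map_pow]
    exact (IsLocalization.Away.algebraMap_isUnit f).pow n
  have hau : IsUnit (algebraMap S (Localization.Away f) a) := h ▸ v.isUnit.mul hfu
  have h1 := Submodule.subset_span (R := ℝ)
    (show (1 : ℝ) ⊗ₜ[ℤ] (d + i) ∈ {v : ℝ ⊗[ℤ] D | ∃ d : D, v = 1 ⊗ₜ[ℤ] d ∧
      ∃ f ∈ 𝒜 d, f ∉ x.asIdeal} from ⟨_, rfl, a, ha, isUnit_algebraMap_notMem hx hau⟩)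
  have h2 := Submodule.subset_span (R := ℝ)
    (show (1 : ℝ) ⊗ₜ[ℤ] i ∈ {v : ℝ ⊗[ℤ] D | ∃ d : D, v = 1 ⊗ₜ[ℤ] d ∧
      ∃ f ∈ 𝒜 d, f ∉ x.asIdeal} from ⟨_, rfl, _, hi, isUnit_algebraMap_notMem hx hfu⟩)
  have h3 := Submodule.sub_mem _ h1 h2
  rwa [← TensorProduct.tmul_sub, add_sub_cancel_right] at h3

omit [AddGroup.FG D] in
-- In `S_f` the inverse of `a` is `b / f`, which is homogeneous.
lemma mem_unitDegrees_of_dvd {f a : S} {d : D} (ha : a ∈ 𝒜 d) {b : S} (hb : SetLike.IsHomogeneousElem 𝒜 b) (h : f = a * b) :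
    d ∈ unitDegrees 𝒜 f := by
  obtain ⟨e, hb⟩ := hb
  have hu : IsUnit (algebraMap S (Localization.Away f) a) :=
    isUnit_of_dvd_unit (map_dvd _ ⟨b, h⟩) (IsLocalization.Away.algebraMap_isUnit f)
  refine ⟨hu.unit, isHomogeneousAway_algebraMap ha, 1, d + e, b, ?_, by rwa [neg_add_cancel_left],
    ?_⟩
  · rw [pow_one, h]; exact SetLike.mul_mem_graded ha hb
  · have h' : algebraMap S (Localization.Away f) f = algebraMap S _ a * algebraMap S _ b := by
      rw [← map_mul, ← h]
    rw [pow_one, h', ← mul_assoc, hu.val_inv_mul, one_mul]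

lemma exists_isRelevant_of_mem {x : PrimeSpectrum S}
    (hx : x ∈ geometricallySemistableLocus 𝒜) : ∃ f, IsRelevant 𝒜 f ∧ f ∉ x.asIdeal := by
  obtain ⟨-, -, hx⟩ := Set.mem_iUnion.mp hx
  rw [orbitConeDim_eq_iff] at hx
  let M : Set D := {d | ∃ f ∈ 𝒜 d, f ∉ x.asIdeal}
  have : Module.Finite ℤ D := Module.Finite.iff_addGroup_fg.mpr inferInstance
  -- `D` is Noetherian over `ℤ`, so finitely many weights of `x` generate the same subgroup as all
  -- of them.
  obtain ⟨t, htM, ht⟩ := (Submodule.fg_span_iff_fg_span_finset_subset (R := ℤ) M).mp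
    (IsNoetherian.noetherian _)
  choose! g hg hgx using fun d (hd : d ∈ M) => hd
  have hhom (s : Finset D) (hs : (s : Set D) ⊆ M) :
      SetLike.IsHomogeneousElem 𝒜 (∏ d ∈ s, g d) :=
    ⟨_, SetLike.prod_mem_graded 𝒜 (fun d => d) g fun d hd => hg d (hs hd)⟩
  refine ⟨∏ d ∈ t, g d, ⟨hhom t htM, ?_⟩, ?_⟩
  · refine finiteIndex_of_span_tmul_eq_top _ ?_
    rw [eq_top_iff, ← hx]
    refine Submodule.span_mono ?_
    rintro _ ⟨d, rfl, hd⟩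
    refine ⟨d, ?_, rfl⟩
    have h1 : d ∈ Submodule.span ℤ (t : Set D) := ht ▸ Submodule.subset_span hd
    have h2 : Submodule.span ℤ (t : Set D) ≤
        AddSubgroup.toIntSubmodule (unitDegrees 𝒜 (∏ d ∈ t, g d)) := by
      refine Submodule.span_le.mpr fun e he => ?_
      refine mem_unitDegrees_of_dvd 𝒜 (hg e (htM he))
        (hhom (t.erase e) fun c hc => htM (Finset.mem_of_mem_erase hc)) ?_
      rw [Finset.mul_prod_erase _ _ he]
    exact h2 h1
  · rw [Ideal.IsPrime.prod_mem_iff]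
    rintro ⟨d, hd, h⟩
    exact hgx d (htM hd) h

theorem geometricallySemistableLocus_eq :
    geometricallySemistableLocus 𝒜 =
      ⋃ f ∈ {f : S | IsRelevant 𝒜 f}, (PrimeSpectrum.basicOpen f : Set (PrimeSpectrum S)) := by
  ext x
  simp only [Set.mem_ofPred_eq, Set.mem_iUnion, SetLike.mem_coe, PrimeSpectrum.mem_basicOpen,
    exists_prop]
  exact ⟨exists_isRelevant_of_mem 𝒜, fun ⟨f, hf, hx⟩ =>
    mem_geometricallySemistableLocus_of_isRelevant 𝒜 hf hx⟩

omit [AddGroup.FG D] in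
theorem iUnion_basicOpen_isRelevant_eq :
    (⋃ f ∈ {f : S | IsRelevant 𝒜 f}, (PrimeSpectrum.basicOpen f : Set (PrimeSpectrum S))) =
      (PrimeSpectrum.zeroLocus (irrelevantIdeal 𝒜 : Set S))ᶜ := by
  ext x
  simp only [irrelevantIdeal, PrimeSpectrum.zeroLocus_span, Set.mem_ofPred_eq, Set.mem_iUnion,
    SetLike.mem_coe, PrimeSpectrum.mem_basicOpen, exists_prop, Set.mem_compl_iff,
    PrimeSpectrum.mem_zeroLocus, Set.not_subset]

end

end DGraded

/-! ### The spectrum of a graded ring over that of its degree-zero part -/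

namespace DGraded

section

variable {A B D : Type*} [CommRing A] [CommRing B] [AddCommGroup D] [DecidableEq D]
  {ℬ : D → AddSubgroup A} [GradedRing ℬ] {φ : B →+* A}

open PrimeSpectrum

/-- A prime of the degree-zero part `B` of `A` that contains `J ∩ B`, for a homogeneous ideal `J` of
`A`, is the contraction of a prime containing `J`. -/
lemma exists_prime_comap_eq_of_isHomogeneous (hφ : Function.Injective φ)
    (h0 : ∀ a, a ∈ ℬ 0 ↔ a ∈ Set.range φ) {J : Ideal A} (hJ : J.IsHomogeneous ℬ)
    (p : PrimeSpectrum B) (hp : J.comap φ ≤ p.asIdeal) :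
    ∃ P : PrimeSpectrum A, J ≤ P.asIdeal ∧ comap φ P = p := by
  -- The degree-zero component of an element of `pA` lies in `p`, as the projection `A → A_0` is
  -- `A_0`-linear. The factor `a` carries the induction through multiplication by scalars.
  have hmap (x : A) (hx : x ∈ p.asIdeal.map φ) (a : A) :
      ∃ b ∈ p.asIdeal, φ b = DirectSum.decompose ℬ (a * x) 0 := by
    induction hx using Submodule.span_induction generalizing a with
    | mem x h =>
      obtain ⟨b, hb, rfl⟩ := h
      obtain ⟨c, hc⟩ := (h0 _).mp (DirectSum.decompose ℬ a 0).2
      refine ⟨c * b, Ideal.mul_mem_left _ _ hb, ?_⟩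
      rw [DirectSum.coe_decompose_mul_of_right_mem_zero ℬ ((h0 _).mpr ⟨b, rfl⟩), map_mul, hc]
    | zero => exact ⟨0, zero_mem _, by simp⟩
    | add x y _ _ hx hy =>
      obtain ⟨b, hb, hb'⟩ := hx a
      obtain ⟨c, hc, hc'⟩ := hy a
      exact ⟨b + c, add_mem hb hc, by simp [hb', hc', mul_add]⟩
    | smul a' x _ hx =>
      rw [smul_eq_mul, ← mul_assoc]
      exact hx _
  let ψ : B →+* A ⧸ J := (Ideal.Quotient.mk J).comp φ
  have : p ∈ Set.range (comap ψ) := by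
    -- A prime is a contraction from `A / J` if it equals the contraction of its own extension. An
    -- element of the latter is `x + j` with `x ∈ pA`, `j ∈ J`; its degree-zero part lies in `p + (J
    -- ∩ B)`.
    rw [mem_range_comap_iff]
    refine le_antisymm (fun b hb => ?_) Ideal.le_comap_map
    rw [Ideal.mem_comap, ← Ideal.map_map, RingHom.comp_apply, ← Ideal.mem_comap,
      Ideal.comap_map_of_surjective _ Ideal.Quotient.mk_surjective, ← RingHom.ker_eq_comap_bot,
      Ideal.mk_ker] at hb
    obtain ⟨x, hx, j, hj, hxj⟩ := Submodule.mem_sup.mp hb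
    obtain ⟨c, hc, hc'⟩ := hmap x hx 1
    rw [one_mul] at hc'
    have hj0 := (hJ.mem_iff.mp hj) 0
    obtain ⟨d, hd⟩ := (h0 _).mp (DirectSum.decompose ℬ j 0).2
    have : b = c + d := hφ (by
      rw [map_add, hc', hd, ← DirectSum.decompose_of_mem_same ℬ ((h0 _).mpr ⟨b, rfl⟩), ← hxj]
      simp)
    rw [this]
    exact add_mem hc (hp (by rwa [Ideal.mem_comap, hd]))
  obtain ⟨P, rfl⟩ := this
  exact ⟨comap (Ideal.Quotient.mk J) P, fun x hx => by
    simp [Ideal.Quotient.eq_zero_iff_mem.mpr hx], rfl⟩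

lemma comap_surjective_of_gradeZero (hφ : Function.Injective φ)
    (h0 : ∀ a, a ∈ ℬ 0 ↔ a ∈ Set.range φ) : Function.Surjective (comap φ) := fun p => by
  obtain ⟨P, -, hP⟩ := exists_prime_comap_eq_of_isHomogeneous hφ h0 (Ideal.IsHomogeneous.bot ℬ) p
    (fun b hb => by
      rw [Ideal.mem_comap, Ideal.mem_bot, map_eq_zero_iff _ hφ] at hb
      exact hb ▸ zero_mem _)
  exact ⟨P, hP⟩

/-- Specializations in the spectrum of the degree-zero part of a graded ring lift. -/
lemma exists_le_comap_eq_of_gradeZero (hφ : Function.Injective φ)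
    (h0 : ∀ a, a ∈ ℬ 0 ↔ a ∈ Set.range φ) {q p : PrimeSpectrum B} (hqp : q ≤ p) :
    ∃ Q P : PrimeSpectrum A, Q ≤ P ∧ comap φ Q = q ∧ comap φ P = p := by
  obtain ⟨Q, rfl⟩ := comap_surjective_of_gradeZero hφ h0 q
  -- `Q` itself need not specialize to a prime over `p`. It is replaced by a minimal prime `Q'` of
  -- its homogeneous core `J`, chosen below a prime `P ⊇ J` over `p`.
  let J := (Q.asIdeal.homogeneousCore ℬ).toIdeal
  have hJQ : J ≤ Q.asIdeal := Ideal.toIdeal_homogeneousCore_le ℬ _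
  have hJ : J.IsHomogeneous ℬ := (Q.asIdeal.homogeneousCore ℬ).isHomogeneous
  have hmem {x : A} (hx : SetLike.IsHomogeneousElem ℬ x) (hxQ : x ∈ Q.asIdeal) : x ∈ J :=
    Ideal.mem_homogeneousCore_of_homogeneous_of_mem hx hxQ
  obtain ⟨P, hJP, rfl⟩ := exists_prime_comap_eq_of_isHomogeneous hφ h0 hJ p
    ((Ideal.comap_mono hJQ).trans hqp)
  obtain ⟨Q', hQ', hQ'P⟩ := Ideal.exists_minimalPrimes_le hJP
  refine ⟨⟨Q', hQ'.1.1⟩, P, hQ'P, PrimeSpectrum.ext (le_antisymm (fun b hb => ?_) fun b hb => ?_),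
    rfl⟩
  -- Elements of a minimal prime of `J` are zero divisors modulo `J`: `b y ∈ J` with `y ∉ J`. As `b`
  -- has degree zero, all `b y_d` lie in `J ⊆ Q`. If `b ∉ Q`, the homogeneous `y_d` lie in `Q`,
  -- hence in `J`, which forces `y ∈ J`.
  · obtain ⟨y, hy, hby⟩ := Ideal.exists_mul_mem_of_mem_minimalPrimes hQ' (show φ b ∈ Q' from hb)
    by_contra hbQ
    refine hy (hJ.mem_iff.mpr fun d => hmem ⟨d, SetLike.coe_mem _⟩ ?_)
    have h1 := hJQ ((hJ.mem_iff.mp hby) d)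
    rw [DirectSum.coe_decompose_mul_of_left_mem_zero ℬ ((h0 _).mpr ⟨b, rfl⟩)] at h1
    exact (Q.2.mem_or_mem h1).resolve_left hbQ
  · exact hQ'.1.2 (hmem ⟨0, (h0 _).mpr ⟨b, rfl⟩⟩ hb)

/-- The spectrum of the degree-zero part of a graded ring carries the quotient topology. -/
lemma isOpen_of_isOpen_preimage_comap (hφ : Function.Injective φ)
    (h0 : ∀ a, a ∈ ℬ 0 ↔ a ∈ Set.range φ) {V : Set (PrimeSpectrum B)}
    (hV : IsOpen (comap φ ⁻¹' V)) : IsOpen V := by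
  rw [← isClosed_compl_iff, ← Set.image_preimage_eq Vᶜ (comap_surjective_of_gradeZero hφ h0)]
  -- The complement of `V` is the image of a closed set; such an image on spectra is closed once it
  -- is stable under specialization.
  refine isClosed_image_of_stableUnderSpecialization φ _ hV.isClosed_compl ?_
  rw [Set.image_preimage_eq Vᶜ (comap_surjective_of_gradeZero hφ h0)]
  intro q p hqp hq
  obtain ⟨Q, P, hQP, rfl, rfl⟩ := exists_le_comap_eq_of_gradeZero hφ h0
    ((le_iff_specializes q p).mpr hqp)
  exact ((le_iff_specializes Q P).mp hQP).mem_closed hV.isClosed_compl hq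

/-- Characters with values in an algebraically closed field extend from a subgroup. -/
lemma exists_addMonoidHom_extension {D : Type*} [AddCommGroup D] {K : Type*} [Field K]
    [IsAlgClosed K] (M : AddSubgroup D) (χ : M →+ Additive Kˣ) :
    ∃ χ' : D →+ Additive Kˣ, ∀ d : M, χ' d = χ d := by
  -- Roots exist in `K`, so `Kˣ` is divisible, and divisible groups are injective over `ℤ` by Baer's
  -- criterion.
  have hroot (n : ℤ) (hn : n ≠ 0) (a : Additive Kˣ) : ∃ b : Additive Kˣ, n • b = a := by
    obtain ⟨z, hz⟩ := IsAlgClosed.exists_pow_nat_eq (a.toMul : K) (Int.natAbs_pos.mpr hn)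
    have hz0 : z ≠ 0 := by
      rintro rfl
      rw [zero_pow (Int.natAbs_ne_zero.mpr hn)] at hz
      exact a.toMul.ne_zero hz.symm
    have hb : n.natAbs • Additive.ofMul (Units.mk0 z hz0) = a :=
      Additive.toMul.injective (Units.ext hz)
    obtain h | h := Int.natAbs_eq n
    · exact ⟨Additive.ofMul (Units.mk0 z hz0), by rw [h, natCast_zsmul, hb]⟩
    · exact ⟨-Additive.ofMul (Units.mk0 z hz0), by rw [h, neg_smul_neg, natCast_zsmul, hb]⟩
  let : DivisibleBy (Additive Kˣ) ℤ :=
    { div := fun a n => if h : n = 0 then 0 else (hroot n h a).choose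
      div_zero := fun a => dif_pos rfl
      div_cancel := fun {n} a hn => by rw [dif_neg hn]; exact (hroot n hn a).choose_spec }
  obtain ⟨f, hf⟩ := (Module.Baer.of_divisible (Additive Kˣ)).extension_property
    (AddSubgroup.toIntSubmodule M).subtype Subtype.val_injective
    (χ.toIntLinearMap : AddSubgroup.toIntSubmodule M →ₗ[ℤ] Additive Kˣ)
  exact ⟨f.toAddMonoidHom, fun d => LinearMap.congr_fun hf d⟩

/-- Two geometric points of the spectrum of a `D`-graded ring `A` that agree on the degree-zero part
differ by a character of `D`, if the degrees of the homogeneous units of `A` form a subgroup of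
finite index. -/
lemma exists_character_of_eq_on_gradeZero {K : Type*} [Field K] [IsAlgClosed K] (x y : A →+* K)
    (hxy : ∀ a ∈ ℬ 0, x a = y a) (H : AddSubgroup D) [H.FiniteIndex]
    (hH : ∀ d ∈ H, ∃ v : Aˣ, (v : A) ∈ ℬ d ∧ ((v⁻¹ : Aˣ) : A) ∈ ℬ (-d)) :
    ∃ χ : D →+ Additive Kˣ, ∀ d, ∀ a ∈ ℬ d, y a = (χ d).toMul * x a := by
  -- With `N` the index and `v` a unit of degree `N d`, the element `a ^ (N - 1) / v` has degree
  -- `-d` and serves as an inverse of `a` up to degree zero.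
  have hinv {d : D} {a : A} (ha : a ∈ ℬ d) (hxa : x a ≠ 0) : ∃ c ∈ ℬ (-d), x c ≠ 0 := by
    obtain ⟨v, -, hv⟩ := hH _ (H.nsmul_index_mem d)
    refine ⟨a ^ (H.index - 1) * (v⁻¹ : Aˣ), ?_, ?_⟩
    · convert SetLike.mul_mem_graded (SetLike.pow_mem_graded (H.index - 1) ha) hv using 1
      obtain ⟨k, hk⟩ := Nat.exists_eq_add_one_of_ne_zero
        (AddSubgroup.FiniteIndex.index_ne_zero (H := H))
      rw [hk, Nat.add_sub_cancel, add_smul, one_smul]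
      abel_nf
    · rw [map_mul, map_pow]
      exact mul_ne_zero (pow_ne_zero _ hxa) ((v⁻¹).isUnit.map x).ne_zero
  -- `a ^ N / v` has degree zero, so `x` and `y` agree on it.
  have hzero {d : D} {a : A} (ha : a ∈ ℬ d) (hxa : x a = 0) : y a = 0 := by
    obtain ⟨v, -, hv⟩ := hH _ (H.nsmul_index_mem d)
    have h := hxy (a ^ H.index * (v⁻¹ : Aˣ)) (by
      convert SetLike.mul_mem_graded (SetLike.pow_mem_graded H.index ha) hv using 1
      rw [add_neg_cancel])
    rw [map_mul, map_pow, hxa, zero_pow AddSubgroup.FiniteIndex.index_ne_zero, zero_mul, map_mul,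
      map_pow, eq_comm, mul_eq_zero, or_iff_left ((v⁻¹).isUnit.map y).ne_zero] at h
    exact eq_zero_of_pow_eq_zero h
  -- The degrees in which `x` does not vanish identically; `hinv` makes this a subgroup. Only here
  -- is the ratio of `y` to `x` determined.
  let M : AddSubgroup D :=
    { carrier := {d | ∃ a ∈ ℬ d, x a ≠ 0}
      zero_mem' := ⟨1, SetLike.one_mem_graded ℬ, by simp⟩
      add_mem' := by
        rintro d e ⟨a, ha, hxa⟩ ⟨b, hb, hxb⟩
        exact ⟨a * b, SetLike.mul_mem_graded ha hb, by rw [map_mul]; exact mul_ne_zero hxa hxb⟩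
      neg_mem' := by
        rintro d ⟨a, ha, hxa⟩
        exact hinv ha hxa }
  choose g hg hgx using fun d : M => d.2
  -- Multiplication by `c` moves `a` and `b` to degree zero, so the ratio `y / x` depends only on
  -- the degree.
  have hcross {d : D} {a b c : A} (ha : a ∈ ℬ d) (hb : b ∈ ℬ d) (hc : c ∈ ℬ (-d)) (hxc : x c ≠ 0) :
      y a * x b = y b * x a := by
    have h1 := hxy (a * c) (by simpa using SetLike.mul_mem_graded ha hc)
    have h2 := hxy (b * c) (by simpa using SetLike.mul_mem_graded hb hc)
    rw [map_mul, map_mul] at h1 h2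
    refine mul_right_cancel₀ hxc ?_
    rw [mul_assoc, h2, mul_assoc, h1]
    ring
  have hy {d : D} {a : A} (ha : a ∈ ℬ d) (hxa : x a ≠ 0) : y a ≠ 0 := by
    obtain ⟨c, hc, hxc⟩ := hinv ha hxa
    have h1 := hxy (a * c) (by simpa using SetLike.mul_mem_graded ha hc)
    rw [map_mul, map_mul] at h1
    exact left_ne_zero_of_mul (h1 ▸ mul_ne_zero hxa hxc)
  have hratio {d : M} {a : A} (ha : a ∈ ℬ d) : y a * x (g d) = y (g d) * x a := by
    obtain ⟨c, hc, hxc⟩ := hinv (hg d) (hgx d)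
    exact hcross ha (hg d) hc hxc
  let χ₀ : M →+ Additive Kˣ := AddMonoidHom.mk'
    (fun d => Additive.ofMul (Units.mk0 (y (g d) / x (g d))
      (div_ne_zero (hy (hg d) (hgx d)) (hgx d)))) (by
    intro d e
    refine Additive.toMul.injective (Units.ext ?_)
    have h := hratio (d := d + e) (a := g d * g e) (SetLike.mul_mem_graded (hg d) (hg e))
    rw [map_mul, map_mul] at h
    have h1 := hgx d
    have h2 := hgx e
    have h3 := hgx (d + e)
    change y (g (d + e)) / x (g (d + e)) = y (g d) / x (g d) * (y (g e) / x (g e))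
    field_simp
    linear_combination -h)
  obtain ⟨χ, hχ⟩ := exists_addMonoidHom_extension M χ₀
  refine ⟨χ, fun d a ha => ?_⟩
  by_cases hxa : x a = 0
  · rw [hxa, mul_zero, hzero ha hxa]
  · have h := hratio (d := ⟨d, a, ha, hxa⟩) ha
    rw [hχ ⟨d, a, ha, hxa⟩]
    have h3 := hgx ⟨d, a, ha, hxa⟩
    change y a = y (g _) / x (g _) * x a
    field_simp
    exact h

end
end DGraded

noncomputable section
namespace DGraded

/-! ### The induced grading of `S_f` -/

section

variable {S D : Type u} [CommRing S] [AddCommGroup D] [DecidableEq D]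
  (𝒜 : D → AddSubgroup S) [GradedRing 𝒜]

open HomogeneousLocalization

/-- The induced grading of `S_f`. -/
def awayGrading (f : S) (d : D) : AddSubgroup (Localization.Away f) where
  carrier := {x | IsHomogeneousAway 𝒜 f d x}
  zero_mem' := ⟨0, 0, 0, by simpa using SetLike.one_mem_graded 𝒜, zero_mem _, by simp⟩
  add_mem' := by
    rintro x y ⟨n, i, a, hi, ha, hx⟩ ⟨m, j, b, hj, hb, hy⟩
    refine ⟨n + m, i + j, a * f ^ m + b * f ^ n, ?_, add_mem ?_ ?_, ?_⟩
    · rw [pow_add]; exact SetLike.mul_mem_graded hi hj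
    · rw [← add_assoc]; exact SetLike.mul_mem_graded ha hj
    · rw [add_comm i, ← add_assoc]; exact SetLike.mul_mem_graded hb hi
    · rw [map_add, map_mul, map_mul, ← hx, ← hy, pow_add, map_mul]; ring
  neg_mem' := by
    rintro x ⟨n, i, a, hi, ha, hx⟩
    exact ⟨n, i, -a, hi, neg_mem ha, by rw [neg_mul, hx, map_neg]⟩

instance (f : S) : SetLike.GradedMonoid (awayGrading 𝒜 f) where
  one_mem := ⟨0, 0, 1, by simpa using SetLike.one_mem_graded 𝒜,
    by simpa using SetLike.one_mem_graded 𝒜, by simp⟩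
  mul_mem _ _ _ _ hx hy := IsHomogeneousAway.mul hx hy

lemma mem_awayGrading_zero_iff {f : S} (a : Localization.Away f) :
    a ∈ awayGrading 𝒜 f 0 ↔
      a ∈ Set.range (algebraMap (Away 𝒜 f) (Localization.Away f)) := by
  constructor
  · intro h
    obtain ⟨t, ht⟩ := exists_val_eq h
    exact ⟨t, ht⟩
  · rintro ⟨t, rfl⟩
    exact isHomogeneousAway_val t

/-- The ring homomorphism `S → ⨁ (S_f)_d`. -/
def toAwayDirectSum (f : S) : S →+* DirectSum D fun d => awayGrading 𝒜 f d :=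
  (DirectSum.toSemiring
    (fun d => (DirectSum.of (fun d => awayGrading 𝒜 f d) d).comp
      (((algebraMap S (Localization.Away f)).toAddMonoidHom.comp (𝒜 d).subtype).codRestrict
        (awayGrading 𝒜 f d) fun a => isHomogeneousAway_algebraMap a.2))
    (by
      rw [DirectSum.one_def]
      exact DirectSum.of_eq_of_gradedMonoid_eq (Sigma.subtype_ext rfl
        (map_one (algebraMap S (Localization.Away f)))))
    (by
      intro i j a b
      refine Eq.trans ?_ (DirectSum.of_mul_of _ _).symm
      exact DirectSum.of_eq_of_gradedMonoid_eq (Sigma.subtype_ext rfl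
        (map_mul (algebraMap S (Localization.Away f)) (a : S) (b : S))))).comp
    (DirectSum.decomposeRingEquiv 𝒜 : S →+* _)

lemma toAwayDirectSum_of_mem (f : S) {d : D} {a : S} (ha : a ∈ 𝒜 d) :
    toAwayDirectSum 𝒜 f a = DirectSum.of (fun d => awayGrading 𝒜 f d) d
      ⟨algebraMap S _ a, isHomogeneousAway_algebraMap ha⟩ := by
  have h : (DirectSum.decomposeRingEquiv 𝒜) a =
      DirectSum.of (fun i => 𝒜 i) d ⟨a, ha⟩ := DirectSum.decompose_of_mem 𝒜 ha
  rw [toAwayDirectSum, RingHom.comp_apply, RingHom.coe_coe, h, DirectSum.toSemiring_of]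
  rfl

variable {𝒜}

lemma isHomogeneousAway_inv {f : S} {d : D} (hf : f ∈ 𝒜 d) {v : (Localization.Away f)ˣ}
    (hv : (v : Localization.Away f) = algebraMap S _ f) :
    IsHomogeneousAway 𝒜 f (-d) (v⁻¹ : (Localization.Away f)ˣ) :=
  ⟨1, d, 1, by rwa [pow_one], by simpa using SetLike.one_mem_graded 𝒜, by
    rw [pow_one, ← hv, Units.inv_mul, map_one]⟩

lemma isUnit_toAwayDirectSum {f : S} (hf : SetLike.IsHomogeneousElem 𝒜 f) :
    IsUnit (toAwayDirectSum 𝒜 f f) := by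
  obtain ⟨d, hf⟩ := hf
  have hu : IsUnit (algebraMap S (Localization.Away f) f) :=
    IsLocalization.Away.algebraMap_isUnit f
  refine .of_mul_eq_one (DirectSum.of (fun d => awayGrading 𝒜 f d) (-d)
    ⟨(hu.unit⁻¹ : (Localization.Away f)ˣ), isHomogeneousAway_inv hf rfl⟩) ?_
  rw [toAwayDirectSum_of_mem 𝒜 f hf, DirectSum.of_mul_of, DirectSum.one_def]
  exact DirectSum.of_eq_of_gradedMonoid_eq
    (Sigma.subtype_ext (add_neg_cancel d) (by exact hu.mul_val_inv))

/-- The grading of `S_f` for a homogeneous `f`. -/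
abbrev awayGradedRing {f : S} (hf : SetLike.IsHomogeneousElem 𝒜 f) :
    GradedRing (awayGrading 𝒜 f) where
  decompose' := Localization.awayLift (toAwayDirectSum 𝒜 f) f (isUnit_toAwayDirectSum hf)
  left_inv x := by
    -- Both sides are ring homomorphisms out of `S_f`, so they may be compared on `S`, and there on
    -- homogeneous elements.
    change ((DirectSum.coeRingHom (awayGrading 𝒜 f)).comp
      (Localization.awayLift (toAwayDirectSum 𝒜 f) f (isUnit_toAwayDirectSum hf))) x =
        RingHom.id _ x
    congr 1
    refine IsLocalization.ringHom_ext (Submonoid.powers f) (RingHom.ext fun a => ?_)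
    simp only [RingHom.comp_apply, Localization.awayLift, IsLocalization.Away.lift_eq,
      RingHom.id_apply]
    induction a using DirectSum.Decomposition.inductionOn 𝒜 with
    | zero => simp
    | homogeneous a => rw [toAwayDirectSum_of_mem 𝒜 f a.2, DirectSum.coeRingHom_of]
    | add a b ha hb => rw [map_add, map_add, ha, hb, map_add]
  right_inv x := by
    induction x using DirectSum.induction_on with
    | zero => simp
    | add x y hx hy => rw [map_add, map_add, hx, hy]
    | of d x =>
      obtain ⟨x, n, i, a, hi, ha, h⟩ := x
      rw [DirectSum.coeAddMonoidHom_of]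
      have hu := (isUnit_toAwayDirectSum hf).pow n
      rw [← map_pow] at hu
      -- Multiplying by the unit that comes from `f ^ n` replaces the fraction `x` by its numerator
      -- `a ∈ S`.
      refine hu.mul_right_cancel ?_
      have h1 := congrArg (Localization.awayLift (toAwayDirectSum 𝒜 f) f
        (isUnit_toAwayDirectSum hf)) h
      rw [map_mul, Localization.awayLift, IsLocalization.Away.lift_eq,
        IsLocalization.Away.lift_eq] at h1
      rw [Localization.awayLift, h1, toAwayDirectSum_of_mem 𝒜 f hi, toAwayDirectSum_of_mem 𝒜 f ha,
        DirectSum.of_mul_of]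
      exact DirectSum.of_eq_of_gradedMonoid_eq (Sigma.subtype_ext rfl h.symm)

end
-- Factorization through quotients of schemes
section

variable {U Y Z : Scheme.{u}}

lemma appLE_congr_hom {f g : U ⟶ Z} (h : f = g) {W : Z.Opens} {V : U.Opens} (e : V ≤ f ⁻¹ᵁ W)
    (e' : V ≤ g ⁻¹ᵁ W) : f.appLE W V e = g.appLE W V e' := by
  subst h
  rfl

lemma map_appLE_apply (f : U ⟶ Z) {W : Z.Opens} {V V' : U.Opens} (e : V ≤ f ⁻¹ᵁ W)
    (i : op V ⟶ op V') (s : Γ(Z, W)) :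
    U.presheaf.map i (f.appLE W V e s) = f.appLE W V' (i.unop.le.trans e) s :=
  congrArg (fun r => r.hom s) (Scheme.Hom.appLE_map f e i)

lemma appLE_map_apply (f : U ⟶ Z) {W W' : Z.Opens} {V : U.Opens} (e : V ≤ f ⁻¹ᵁ W)
    (i : op W' ⟶ op W) (s : Γ(Z, W')) :
    f.appLE W V e (Z.presheaf.map i s) =
      f.appLE W' V (e.trans (f.preimage_mono i.unop.le)) s :=
  congrArg (fun r => r.hom s) (Scheme.Hom.map_appLE f e i)

lemma comp_appLE_apply (f : U ⟶ Y) (g : Y ⟶ Z) {W : Z.Opens} {V : Y.Opens} {V' : U.Opens}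
    (e : V ≤ g ⁻¹ᵁ W) (e' : V' ≤ f ⁻¹ᵁ V) (s : Γ(Z, W)) :
    f.appLE V V' e' (g.appLE W V e s) =
      (f ≫ g).appLE W V' (e'.trans (f.preimage_mono e)) s :=
  congrArg (fun r => r.hom s) (Scheme.Hom.appLE_comp_appLE f g W V V' e e')

/-- A surjective morphism `φ : U ⟶ Y` with `𝒪_Y ⊆ φ_* 𝒪_U` is an epimorphism. -/
lemma epi_of_surjective_of_app_injective (φ : U ⟶ Y) [Surjective φ]
    (hφ : ∀ V : Y.Opens, Function.Injective (φ.app V)) : Epi φ where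
  left_cancellation {Z} f g h := by
    have hb : f.base = g.base := by
      ext y
      obtain ⟨x, rfl⟩ := φ.surjective y
      change (φ ≫ f) x = (φ ≫ g) x
      rw [h]
    refine Scheme.Hom.ext hb fun W => ?_
    -- Once the maps of spaces agree, the two comorphisms still land over formally different opens;
    -- `eqToHom` identifies these.
    have key : (f.app W ≫ Y.presheaf.map (eqToHom congr((TopologicalSpace.Opens.map
        $hb.symm).obj W)).op) ≫ φ.app (g ⁻¹ᵁ W) = g.app W ≫ φ.app (g ⁻¹ᵁ W) := by
      rw [Category.assoc, Scheme.Hom.app_eq_appLE φ, Scheme.Hom.map_appLE]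
      refine (Scheme.Hom.comp_appLE φ f W _ _).symm.trans
        (Eq.trans ?_ (Scheme.Hom.comp_appLE φ g W _ le_rfl))
      exact appLE_congr_hom h _ _
    ext s
    exact hφ _ (congrArg (fun r => r.hom s) key)

/-- The factorization property of quotients in the category of schemes. -/
lemma exists_comp_eq_of_quotient (φ : U ⟶ Y) (ψ : U ⟶ Z) [Surjective φ]
    (hsub : ∀ V : Set Y, IsOpen (φ ⁻¹' V) → IsOpen V)
    (hinj : ∀ V : Y.Opens, Function.Injective (φ.app V))
    (hpt : ∀ x y, φ x = φ y → ψ x = ψ y)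
    (hsec : ∀ (V : Y.Opens) (W : Z.Opens) (h : φ ⁻¹ᵁ V ≤ ψ ⁻¹ᵁ W) (s : Γ(Z, W)),
      ψ.appLE W (φ ⁻¹ᵁ V) h s ∈ Set.range (φ.app V)) :
    ∃ χ : Y ⟶ Z, φ ≫ χ = ψ := by
  -- The map of spaces picks any point of the fibre of `φ`; `hpt` makes the choice irrelevant, and
  -- `hsub` makes the map continuous.
  let b : Y → Z := fun y => ψ (φ.surjective y).choose
  have hb (x : U) : b (φ x) = ψ x := hpt _ _ (φ.surjective (φ x)).choose_spec
  have hb' : b ∘ φ = ψ := funext hb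
  have hcont : Continuous b := by
    refine ⟨fun W hW => hsub _ ?_⟩
    rw [← Set.preimage_comp, hb']
    exact hW.preimage ψ.continuous
  let B : (Y : TopCat) ⟶ (Z : TopCat) := TopCat.ofHom ⟨b, hcont⟩
  have hle (W : Z.Opens) : φ ⁻¹ᵁ ((TopologicalSpace.Opens.map B).obj W) ≤ ψ ⁻¹ᵁ W := fun x hx => by
    change ψ x ∈ W
    rw [← hb x]
    exact hx
  -- A section pulled back along `ψ` descends to `Y` by `hsec`. Injectivity of `φ.app` makes the
  -- descent unique, hence a ring homomorphism compatible with restriction.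
  choose c hc using fun (W : Z.Opens) (s : Γ(Z, W)) =>
    hsec ((TopologicalSpace.Opens.map B).obj W) W (hle W) s
  let C (W : Z.Opens) : Γ(Z, W) →+* Γ(Y, (TopologicalSpace.Opens.map B).obj W) :=
    { toFun := c W
      map_one' := hinj _ (by rw [hc, map_one, map_one])
      map_mul' := fun s t => hinj _ (by rw [map_mul, hc, hc, hc, map_mul])
      map_zero' := hinj _ (by rw [hc, map_zero, map_zero])
      map_add' := fun s t => hinj _ (by rw [map_add, hc, hc, hc, map_add]) }
  let F : Y.toPresheafedSpace.Hom Z.toPresheafedSpace :=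
    { base := B
      c :=
        { app := fun W => CommRingCat.ofHom (C W.unop)
          naturality := fun W W' i => by
            ext s
            apply hinj
            change φ.app _ (c W'.unop (Z.presheaf.map i s)) =
              φ.app _ (Y.presheaf.map ((TopologicalSpace.Opens.map B).map i.unop).op
                (c W.unop s))
            refine (hc _ _).trans (Eq.trans ?_ (congrArg (fun r => r.hom (c W.unop s))
              (φ.naturality ((TopologicalSpace.Opens.map B).map i.unop).op)).symm)
            refine Eq.trans ?_ (congrArg (U.presheaf.map _) (hc _ s)).symm
            exact (appLE_map_apply ψ _ i s).trans (map_appLE_apply ψ (hle _) _ s).symm } }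
  let F' : Y.toPresheafedSpace ⟶ Z.toPresheafedSpace := F
  let φ' : U.toPresheafedSpace ⟶ Y.toPresheafedSpace := φ.toHom
  let ψ' : U.toPresheafedSpace ⟶ Z.toPresheafedSpace := ψ.toHom
  have hcomp : φ' ≫ F' = ψ' := by
    refine PresheafedSpace.ext _ _ (by ext x; exact hb x) ?_
    ext W s
    rw [NatTrans.comp_app, Functor.whiskerRight_app, eqToHom_app]
    change (U.presheaf.map _) (φ.app _ (c W s)) = ψ.app W s
    refine (congrArg (U.presheaf.map _) (hc _ s)).trans ?_
    refine (map_appLE_apply ψ (hle _) _ s).trans ?_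
    rw [Scheme.Hom.app_eq_appLE]
  refine ⟨⟨⟨F, fun y => ?_⟩⟩, ?_⟩
  -- The stalk map of `ψ` is local and is the new stalk map followed by that of `φ`, up to an
  -- identification of stalks. If a composite is local, so is its first factor.
  · obtain ⟨x, rfl⟩ := φ.surjective y
    have h1 := PresheafedSpace.stalkMap.comp φ' F' x
    have h2 := PresheafedSpace.stalkMap.congr_hom _ _ hcomp x
    rw [h1] at h2
    have h3 : IsLocalHom (ψ'.stalkMap x).hom := ψ.prop x
    have h4 {A : CommRingCat} (e : A = Z.presheaf.stalk (ψ'.base x)) :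
        IsLocalHom (eqToHom e ≫ ψ'.stalkMap x).hom := by
      rw [CommRingCat.hom_comp]
      infer_instance
    have h5 : IsLocalHom (F'.stalkMap (φ'.base x) ≫ φ'.stalkMap x).hom := h2 ▸ h4 _
    rw [CommRingCat.hom_comp] at h5
    exact isLocalHom_of_comp (F'.stalkMap (φ'.base x)).hom (φ'.stalkMap x).hom
  · apply Scheme.Hom.ext'
    apply LocallyRingedSpace.Hom.ext'
    exact hcomp

end

/-! ### Geometric quotients are categorical -/

section

variable {B : Scheme.{u}} {G X : Over B} [GrpObj G] [ModObj G X] {U : X.left.Opens}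
  {hU : IsInvariantOpen G X U} {Y Z : Scheme.{u}} {φ : U.toScheme ⟶ Y}

lemma IsGeometricQuotient.epi (h : IsGeometricQuotient hU φ) : Epi φ :=
  have := h.surjective
  epi_of_surjective_of_app_injective φ h.app_injective

/-- A geometric quotient is a categorical quotient. -/
lemma IsGeometricQuotient.exists_comp_eq (h : IsGeometricQuotient hU φ) {ψ : U.toScheme ⟶ Z}
    (hψ : actionOn hU ≫ ψ = projectionOn G U ≫ ψ) : ∃ χ : Y ⟶ Z, φ ≫ χ = ψ := by
  have := h.surjective
  refine exists_comp_eq_of_quotient φ ψ h.submersive h.app_injective (fun x y hxy => ?_)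
    fun V W hVW s => ?_
  -- Points with the same image come from a point of `U ×_Y U`, which lifts to `G × U` by `orbits`;
  -- there the two composites with `ψ` agree.
  · obtain ⟨z, rfl, rfl⟩ := Scheme.Pullback.exists_preimage_pullback x y hxy
    have := h.orbits
    obtain ⟨w, rfl⟩ := (pullback.lift (actionOn hU) (projectionOn G U) h.invariant).surjective z
    simp only [← Scheme.Hom.comp_apply, pullback.lift_fst, pullback.lift_snd, hψ]
  · rw [h.mem_range_app_iff]
    intro W' h₁ h₂
    rw [← ConcreteCategory.comp_apply, ← ConcreteCategory.comp_apply,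
      Scheme.Hom.appLE_comp_appLE, Scheme.Hom.appLE_comp_appLE]
    simp only [hψ]

/-- Geometric quotients are unique up to a unique isomorphism. -/
lemma IsGeometricQuotient.existsUnique_iso (h : IsGeometricQuotient hU φ) {ψ : U.toScheme ⟶ Z}
    (h' : IsGeometricQuotient hU ψ) : ∃! e : Y ≅ Z, φ ≫ e.hom = ψ := by
  have := h.epi
  have := h'.epi
  obtain ⟨χ, hχ⟩ := h.exists_comp_eq h'.invariant
  obtain ⟨χ', hχ'⟩ := h'.exists_comp_eq h.invariant
  refine ⟨⟨χ, χ', ?_, ?_⟩, hχ, fun e he => ?_⟩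
  · rw [← cancel_epi φ, reassoc_of% hχ, hχ', Category.comp_id]
  · rw [← cancel_epi ψ, reassoc_of% hχ', hχ, Category.comp_id]
  · ext1
    rw [← cancel_epi φ, he, hχ]

end
-- The coaction on `S_f`: invariants and geometric orbits
section

variable {S D : Type u} [CommRing S] [AddCommGroup D] [DecidableEq D]
  (𝒜 : D → AddSubgroup S) [GradedRing 𝒜]

open HomogeneousLocalization

variable (R : Type u) [CommRing R] [Algebra R S]

variable (D) in
/-- The localization map `R[D] ⊗ S → R[D] ⊗ S_f`. -/
def tensorAwayMap (f : S) : AddMonoidAlgebra R D ⊗[R] S →+*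
    AddMonoidAlgebra R D ⊗[R] Localization.Away f :=
  (Algebra.TensorProduct.map (AlgHom.id (AddMonoidAlgebra R D) (AddMonoidAlgebra R D))
    (IsScalarTower.toAlgHom R S (Localization.Away f))).toRingHom

omit [DecidableEq D] in
lemma tensorAwayMap_tmul (f : S) (c : AddMonoidAlgebra R D) (a : S) :
    tensorAwayMap D R f (c ⊗ₜ a) = c ⊗ₜ algebraMap S (Localization.Away f) a := rfl

-- Localization commutes with base change. This makes `Spec R[D] × D(f)` an open subscheme of `Spec
-- R[D] × Spec S`.
omit [DecidableEq D] in
lemma isLocalization_tensorAwayMap (f : S) :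
    letI := (tensorAwayMap D R f).toAlgebra
    IsLocalization.Away ((1 : AddMonoidAlgebra R D) ⊗ₜ[R] f)
      (AddMonoidAlgebra R D ⊗[R] Localization.Away f) := by
  let := (tensorAwayMap D R f).toAlgebra
  have : IsScalarTower (AddMonoidAlgebra R D) (AddMonoidAlgebra R D ⊗[R] S)
      (AddMonoidAlgebra R D ⊗[R] Localization.Away f) :=
    IsScalarTower.of_algebraMap_eq (R := AddMonoidAlgebra R D) (S := AddMonoidAlgebra R D ⊗[R] S)
      (A := AddMonoidAlgebra R D ⊗[R] Localization.Away f) fun x => by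
      change x ⊗ₜ[R] 1 = tensorAwayMap D R f (x ⊗ₜ 1)
      rw [tensorAwayMap_tmul, map_one]
  have h := IsLocalization.tensorProduct_tensorProduct_right R (AddMonoidAlgebra R D)
    (Submonoid.powers f) (Localization.Away f) (by ext a; rfl)
  rwa [Submonoid.map_powers] at h

omit [DecidableEq D] in
lemma isUnit_single_tmul_one {A : Type*} [CommRing A] [Algebra R A] (d : D) :
    IsUnit ((AddMonoidAlgebra.single d (1 : R)) ⊗ₜ[R] (1 : A)) := by
  refine .of_mul_eq_one ((AddMonoidAlgebra.single (-d) (1 : R)) ⊗ₜ[R] (1 : A)) ?_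
  rw [Algebra.TensorProduct.tmul_mul_tmul, AddMonoidAlgebra.single_mul_single, add_neg_cancel,
    mul_one, mul_one]
  rfl

variable {𝒜 R} {ρ : S →+* AddMonoidAlgebra R D ⊗[R] S}
  (hρ : ∀ d, ∀ a ∈ 𝒜 d, ρ a = AddMonoidAlgebra.single d (1 : R) ⊗ₜ[R] a)

-- The image is `χ^d ⊗ f`, a product of the units `χ^d ⊗ 1` and `1 ⊗ f`.
include hρ in
omit [DecidableEq D] [GradedRing 𝒜] in
lemma isUnit_tensorAwayMap_coaction {f : S} (hf : SetLike.IsHomogeneousElem 𝒜 f) :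
    IsUnit (((tensorAwayMap D R f).comp ρ) f) := by
  obtain ⟨d, hf⟩ := hf
  rw [RingHom.comp_apply, hρ d f hf, tensorAwayMap_tmul]
  have h1 : IsUnit ((1 : AddMonoidAlgebra R D) ⊗ₜ[R]
      algebraMap S (Localization.Away f) f) :=
    (IsLocalization.Away.algebraMap_isUnit f).map
      (Algebra.TensorProduct.includeRight (R := R) (A := AddMonoidAlgebra R D)
        (B := Localization.Away f))
  have h2 := (isUnit_single_tmul_one R (A := Localization.Away f) d).mul h1
  rwa [Algebra.TensorProduct.tmul_mul_tmul, mul_one, one_mul] at h2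

/-- The coaction `S_f → R[D] ⊗ S_f` that extends the coaction `ρ` on `S`. -/
def coactionAway {f : S} (hf : SetLike.IsHomogeneousElem 𝒜 f) :
    Localization.Away f →+* AddMonoidAlgebra R D ⊗[R] Localization.Away f :=
  Localization.awayLift ((tensorAwayMap D R f).comp ρ) f (isUnit_tensorAwayMap_coaction hρ hf)

omit [DecidableEq D] [GradedRing 𝒜] in
lemma coactionAway_algebraMap {f : S} (hf : SetLike.IsHomogeneousElem 𝒜 f) (a : S) :
    coactionAway hρ hf (algebraMap S _ a) = tensorAwayMap D R f (ρ a) :=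
  IsLocalization.Away.lift_eq f (isUnit_tensorAwayMap_coaction hρ hf) a

omit [DecidableEq D] [GradedRing 𝒜] in
lemma coactionAway_of_isHomogeneousAway {f : S} (hf : SetLike.IsHomogeneousElem 𝒜 f) {d : D}
    {x : Localization.Away f} (hx : IsHomogeneousAway 𝒜 f d x) :
    coactionAway hρ hf x = AddMonoidAlgebra.single d (1 : R) ⊗ₜ[R] x := by
  obtain ⟨n, i, a, hi, ha, h⟩ := hx
  have hu : IsUnit (coactionAway hρ hf (algebraMap S _ (f ^ n))) := by
    rw [map_pow]
    exact ((IsLocalization.Away.algebraMap_isUnit f).pow n).map _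
  refine hu.mul_right_cancel ?_
  rw [← map_mul, h, coactionAway_algebraMap, coactionAway_algebraMap, hρ _ _ hi, hρ _ _ ha,
    tensorAwayMap_tmul, tensorAwayMap_tmul, Algebra.TensorProduct.tmul_mul_tmul,
    AddMonoidAlgebra.single_mul_single, mul_one, h]

variable (D R) in
/-- The coefficient of `χ^0`, as a map `R[D] ⊗ A → A`. -/
def tensorCoeffZero (A : Type u) [CommRing A] [Algebra R A] :
    AddMonoidAlgebra R D ⊗[R] A →+ A :=
  (TensorProduct.lift ((LinearMap.lsmul R A : R →ₗ[R] A →ₗ[R] A).comp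
    ((Finsupp.lapply 0).comp (AddMonoidAlgebra.coeffLinearEquiv R).toLinearMap))).toAddMonoidHom

lemma tensorCoeffZero_single_tmul (A : Type u) [CommRing A] [Algebra R A] (d : D) (x : A) :
    tensorCoeffZero D R A (AddMonoidAlgebra.single d (1 : R) ⊗ₜ[R] x) =
      if d = 0 then x else 0 := by
  change (Finsupp.single d (1 : R)) 0 • x = _
  rw [Finsupp.single_apply]
  split_ifs <;> simp

/-- The invariant elements of `S_f` are those of degree zero. -/
lemma mem_range_of_coactionAway_eq {f : S} (hf : SetLike.IsHomogeneousElem 𝒜 f)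
    {x : Localization.Away f} (hx : coactionAway hρ hf x = 1 ⊗ₜ[R] x) :
    x ∈ Set.range (algebraMap (Away 𝒜 f) (Localization.Away f)) := by
  let := awayGradedRing hf
  -- The coefficient of `χ^0` in the coaction of `y` is the degree-zero component of `y`; for the
  -- invariant `x` it is `x` itself.
  have h (y : Localization.Away f) : tensorCoeffZero D R _ (coactionAway hρ hf y) =
      DirectSum.decompose (awayGrading 𝒜 f) y 0 := by
    induction y using DirectSum.Decomposition.inductionOn (awayGrading 𝒜 f) with
    | zero => simp
    | @homogeneous i a =>
      rw [coactionAway_of_isHomogeneousAway hρ hf a.2, tensorCoeffZero_single_tmul,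
        DirectSum.decompose_coe]
      split_ifs with h
      · subst h
        rw [DirectSum.of_eq_same]
      · rw [DirectSum.of_eq_of_ne _ _ _ (Ne.symm h), ZeroMemClass.coe_zero]
    | add a b ha hb => simp [ha, hb]
  have h1 := h x
  rw [hx, AddMonoidAlgebra.one_def, tensorCoeffZero_single_tmul, if_pos rfl] at h1
  rw [← mem_awayGrading_zero_iff, h1]
  exact SetLike.coe_mem _

/-- The point `h` of `Spec R[D] × D(f)` is the pair of a character `χ` and `x`: if `y = χ x` on
homogeneous elements, the action of `χ` carries `x` to `y`. -/
lemma exists_ringHom_of_eq_on_away {f : S} (hf : IsRelevant 𝒜 f) {K : Type u} [Field K]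
    [IsAlgClosed K] (x y : Localization.Away f →+* K)
    (hxy : ∀ t : Away 𝒜 f, x t.val = y t.val) :
    ∃ h : AddMonoidAlgebra R D ⊗[R] Localization.Away f →+* K,
      h.comp (coactionAway hρ hf.homogeneous) = y ∧
      h.comp (Algebra.TensorProduct.includeRight (R := R) (A := AddMonoidAlgebra R D)
        (B := Localization.Away f)).toRingHom = x := by
  let := awayGradedRing hf.homogeneous
  have := hf.finiteIndex
  obtain ⟨χ, hχ⟩ := exists_character_of_eq_on_gradeZero (ℬ := awayGrading 𝒜 f) x y
    (fun a ha => by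
      obtain ⟨t, rfl⟩ := (mem_awayGrading_zero_iff 𝒜 a).mp ha
      exact hxy t)
    (unitDegrees 𝒜 f) (fun d hd => hd)
  -- `K` becomes an `R`-algebra through `x`, so that `x` and the character combine over `R`.
  let : Algebra R K := (x.comp (algebraMap R _)).toAlgebra
  let x' : Localization.Away f →ₐ[R] K := { x with commutes' := fun _ => rfl }
  let χ' : Multiplicative D →* K :=
    (Units.coeHom K).comp (AddMonoidHom.toMultiplicativeLeft χ)
  let h := Algebra.TensorProduct.lift (AddMonoidAlgebra.lift R K D χ') x' fun _ _ => .all _ _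
  refine ⟨h.toRingHom, ?_, ?_⟩
  · ext a
    induction a using DirectSum.Decomposition.inductionOn (awayGrading 𝒜 f) with
    | zero => simp
    | homogeneous a =>
      rw [RingHom.comp_apply, coactionAway_of_isHomogeneousAway hρ hf.homogeneous a.2, hχ _ _ a.2]
      change h (_ ⊗ₜ _) = _
      rw [Algebra.TensorProduct.lift_tmul, AddMonoidAlgebra.lift_single, one_smul]
      rfl
    | add a b ha hb => rw [map_add, map_add, ha, hb]
  · ext a
    change h (1 ⊗ₜ a) = x a
    rw [Algebra.TensorProduct.lift_tmul, map_one, one_mul]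
    rfl

end
-- Gluing the chart projections
section

variable {S D : Type u} [CommRing S] [AddCommGroup D] [DecidableEq D]
  {𝒜 : D → AddSubgroup S} [GradedRing 𝒜]

open HomogeneousLocalization

variable (𝒜) in
/-- The open subset `⋃ D(f)` of `Spec S`, for `f` relevant. -/
def quotientLocus : (Spec (.of S)).Opens :=
  ⨆ f : RelevantElement 𝒜, PrimeSpectrum.basicOpen f.val

lemma mem_quotientLocus {x : Spec (.of S)} :
    x ∈ quotientLocus 𝒜 ↔ ∃ f : RelevantElement 𝒜, f.val ∉ x.asIdeal :=
  TopologicalSpace.Opens.mem_iSup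

lemma range_Spec_map_away {R : Type u} [CommRing R] (f : R) :
    Set.range (Spec.map (CommRingCat.ofHom (algebraMap R (Localization.Away f)))) =
      {x : Spec (.of R) | f ∉ x.asIdeal} :=
  PrimeSpectrum.localization_away_comap_range (Localization.Away f) f

instance {R : Type u} [CommRing R] (f : R) :
    IsOpenImmersion (Spec.map (CommRingCat.ofHom (algebraMap R (Localization.Away f)))) :=
  IsOpenImmersion.of_isLocalization f

/-- The inclusion of `D(f) = Spec S_f` in `⋃ D(f)`. -/
def awayIncl (f : RelevantElement 𝒜) :
    Spec (.of (Localization.Away f.val)) ⟶ (quotientLocus 𝒜).toScheme :=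
  IsOpenImmersion.lift (quotientLocus 𝒜).ι
    (Spec.map (CommRingCat.ofHom (algebraMap S (Localization.Away f.val)))) (by
      rw [range_Spec_map_away, Scheme.Opens.range_ι]
      exact fun x hx => mem_quotientLocus.mpr ⟨f, hx⟩)

lemma awayIncl_ι (f : RelevantElement 𝒜) : awayIncl f ≫ (quotientLocus 𝒜).ι =
    Spec.map (CommRingCat.ofHom (algebraMap S (Localization.Away f.val))) :=
  IsOpenImmersion.lift_fac _ _ _

instance (f : RelevantElement 𝒜) : IsOpenImmersion (awayIncl f) := by
  have : IsOpenImmersion (awayIncl f ≫ (quotientLocus 𝒜).ι) := by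
    rw [awayIncl_ι]
    infer_instance
  exact IsOpenImmersion.of_comp _ (quotientLocus 𝒜).ι

lemma mem_range_awayIncl {f : RelevantElement 𝒜} {x : (quotientLocus 𝒜).toScheme} :
    x ∈ Set.range (awayIncl f) ↔ f.val ∉ ((quotientLocus 𝒜).ι x).asIdeal := by
  rw [← Function.Injective.mem_set_image (quotientLocus 𝒜).ι.isOpenEmbedding.injective,
    ← Set.range_comp, ← TopCat.coe_comp, ← Scheme.Hom.comp_base, awayIncl_ι, range_Spec_map_away]
  rfl

lemma isUnit_algebraMap_away_of_le {f g : RelevantElement 𝒜} (h : f ≤ g) :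
    IsUnit (algebraMap S (Localization.Away f.val) g.val) :=
  isUnit_of_dvd_unit (map_dvd _ ⟨_, h.choose_spec.2⟩)
    (IsLocalization.Away.algebraMap_isUnit f.val)

/-- The canonical map `S_g → S_f` for `f ≤ g`. -/
def awayTransition {f g : RelevantElement 𝒜} (h : f ≤ g) :
    Localization.Away g.val →+* Localization.Away f.val :=
  Localization.awayLift (algebraMap S _) g.val (isUnit_algebraMap_away_of_le h)

lemma awayTransition_comp_algebraMap {f g : RelevantElement 𝒜} (h : f ≤ g) :
    (awayTransition h).comp (algebraMap S _) = algebraMap S _ :=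
  IsLocalization.Away.lift_comp (S := Localization.Away g.val) (P := Localization.Away f.val) g.val
    (isUnit_algebraMap_away_of_le h)

lemma awayTransition_comp_algebraMap_away {f g : RelevantElement 𝒜} (h : f ≤ g) :
    (awayTransition h).comp (algebraMap (Away 𝒜 g.val) _) =
      (algebraMap (Away 𝒜 f.val) _).comp (chartMap h) :=
  RingHom.ext fun y => (val_chartMap_algebraMap h y).symm

/-- The open immersion `D(f) ⟶ D(g)` for `f ≤ g`. -/
def awayHom {f g : RelevantElement 𝒜} (h : f ≤ g) :
    Spec (.of (Localization.Away f.val)) ⟶ Spec (.of (Localization.Away g.val)) :=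
  Spec.map (CommRingCat.ofHom (awayTransition h))

lemma awayHom_awayIncl {f g : RelevantElement 𝒜} (h : f ≤ g) :
    awayHom h ≫ awayIncl g = awayIncl f := by
  rw [awayHom, ← cancel_mono (quotientLocus 𝒜).ι, Category.assoc, awayIncl_ι, awayIncl_ι,
    ← Spec.map_comp, ← CommRingCat.ofHom_comp, awayTransition_comp_algebraMap]

lemma awayHom_refl (f : RelevantElement 𝒜) : awayHom (le_refl f) = 𝟙 _ := by
  rw [← cancel_mono (awayIncl f), awayHom_awayIncl, Category.id_comp]

lemma awayHom_trans {f g k : RelevantElement 𝒜} (h : f ≤ g) (h' : g ≤ k) :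
    awayHom (h.trans h') = awayHom h ≫ awayHom h' := by
  rw [← cancel_mono (awayIncl k), Category.assoc, awayHom_awayIncl, awayHom_awayIncl,
    awayHom_awayIncl]

instance isOpenImmersion_awayHom {f g : RelevantElement 𝒜} (h : f ≤ g) :
    IsOpenImmersion (awayHom h) := by
  have : IsOpenImmersion (awayHom h ≫ awayIncl g) := by
    rw [awayHom_awayIncl]
    infer_instance
  exact IsOpenImmersion.of_comp _ (awayIncl g)

/-- The intersection of `D(f)` and `D(g)` is `D(fg)`, and `fg` is again relevant. This is the
directedness needed to glue along the `D(f)`. -/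
lemma exists_pullback_lift_awayHom_eq {f g : RelevantElement 𝒜}
    (x : (pullback (awayIncl f) (awayIncl g)).carrier) :
    ∃ (k : RelevantElement 𝒜) (hf : k ≤ f) (hg : k ≤ g) (y : Spec (.of (Localization.Away k.val))),
      pullback.lift (awayHom hf) (awayHom hg)
        ((awayHom_awayIncl hf).trans (awayHom_awayIncl hg).symm) y = x := by
  let k : RelevantElement 𝒜 := ⟨f.val * g.val, f.isRelevant.mul g.isRelevant.homogeneous⟩
  have hf : k ≤ f := ⟨g.val, g.isRelevant.homogeneous, rfl⟩
  have hg : k ≤ g := ⟨f.val, f.isRelevant.homogeneous, mul_comm _ _⟩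
  have hxf : (pullback.fst (awayIncl f) (awayIncl g) ≫ awayIncl f) x ∈ Set.range (awayIncl f) :=
    ⟨_, rfl⟩
  have hxg : (pullback.fst (awayIncl f) (awayIncl g) ≫ awayIncl f) x ∈
      Set.range (awayIncl g) := by
    rw [pullback.condition]
    exact ⟨_, rfl⟩
  have hxk : (pullback.fst (awayIncl f) (awayIncl g) ≫ awayIncl f) x ∈
      Set.range (awayIncl k) := by
    rw [mem_range_awayIncl] at hxf hxg ⊢
    exact fun h => ((PrimeSpectrum.isPrime _).mem_or_mem h).elim hxf hxg
  obtain ⟨y, hy⟩ := hxk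
  refine ⟨k, hf, hg, y, (pullback.fst (awayIncl f) (awayIncl g) ≫
    awayIncl f).isOpenEmbedding.injective ?_⟩
  rw [← Scheme.Hom.comp_apply, pullback.lift_fst_assoc, awayHom_awayIncl, hy]

variable (𝒜) in
/-- The open cover of `⋃ D(f)` by the `D(f)`. -/
def awayCover : (quotientLocus 𝒜).toScheme.OpenCover where
  I₀ := RelevantElement 𝒜
  X f := Spec (.of (Localization.Away f.val))
  f f := awayIncl f
  mem₀ := by
    rw [Scheme.presieve₀_mem_precoverage_iff]
    refine ⟨fun x => ?_, inferInstance⟩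
    obtain ⟨f, hf⟩ := mem_quotientLocus.mp x.2
    exact ⟨f, mem_range_awayIncl.mpr hf⟩

instance : Preorder (awayCover 𝒜).I₀ := inferInstanceAs (Preorder (RelevantElement 𝒜))

instance : Scheme.Cover.LocallyDirected (awayCover 𝒜) where
  trans h := awayHom (leOfHom h)
  trans_id f := awayHom_refl f
  trans_comp h h' := awayHom_trans (leOfHom h) (leOfHom h')
  w h := awayHom_awayIncl (leOfHom h)
  directed {f g} x := by
    obtain ⟨k, hf, hg, y, hy⟩ := exists_pullback_lift_awayHom_eq (𝒜 := 𝒜) (f := f) (g := g) x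
    exact ⟨k, homOfLE hf, homOfLE hg, y, hy⟩
  property_trans h := isOpenImmersion_awayHom (leOfHom h)

/-- The morphism `D(f) ⟶ D_+(f)` given by `S_(f) ⊆ S_f`. -/
def chartProjection (f : RelevantElement 𝒜) :
    Spec (.of (Localization.Away f.val)) ⟶ Spec (.of (Away 𝒜 f.val)) :=
  Spec.map (CommRingCat.ofHom (algebraMap (Away 𝒜 f.val) (Localization.Away f.val)))

lemma awayHom_chartProjection {f g : RelevantElement 𝒜} (h : f ≤ g) :
    awayHom h ≫ chartProjection g ≫ Proj.ι g = chartProjection f ≫ Proj.ι f := by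
  rw [awayHom, chartProjection, ← Spec.map_comp_assoc, ← CommRingCat.ofHom_comp,
    awayTransition_comp_algebraMap_away, CommRingCat.ofHom_comp, Spec.map_comp_assoc]
  exact congrArg (chartProjection f ≫ ·) (colimit.w (chartFunctor 𝒜) (homOfLE h))

variable (𝒜) in
/-- The canonical morphism `⋃ D(f) ⟶ Proj^D(S)`. -/
def quotientMap : (quotientLocus 𝒜).toScheme ⟶ Proj 𝒜 :=
  (awayCover 𝒜).glueMorphismsOfLocallyDirected (fun f => chartProjection f ≫ Proj.ι f)
    fun h => awayHom_chartProjection (leOfHom h)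

lemma awayIncl_quotientMap (f : RelevantElement 𝒜) :
    awayIncl f ≫ quotientMap 𝒜 = chartProjection f ≫ Proj.ι f :=
  (awayCover 𝒜).map_glueMorphismsOfLocallyDirected (fun f => chartProjection f ≫ Proj.ι f)
    (fun h => awayHom_chartProjection (leOfHom h)) f

lemma isCanonicalProjection_quotientMap :
    IsCanonicalProjection 𝒜 (quotientLocus 𝒜) (quotientMap 𝒜) := by
  intro f j hj
  have : j = awayIncl f := (cancel_mono (quotientLocus 𝒜).ι).mp (hj.trans (awayIncl_ι f).symm)
  subst this
  exact awayIncl_quotientMap f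

end
-- The topology of `Proj^D(S)` and of the projection
section

variable {S D : Type u} [CommRing S] [AddCommGroup D] [DecidableEq D]
  {𝒜 : D → AddSubgroup S} [GradedRing 𝒜]

open HomogeneousLocalization

instance (f : RelevantElement 𝒜) : IsOpenImmersion (Proj.ι f) :=
  inferInstanceAs (IsOpenImmersion (colimit.ι (chartFunctor 𝒜) f))

lemma Proj.exists_ι_eq (y : Proj 𝒜) : ∃ (f : RelevantElement 𝒜) (z : _), Proj.ι f z = y :=
  Scheme.IsLocallyDirected.ι_jointly_surjective (chartFunctor 𝒜) y

lemma Proj.ι_eq_ι_iff {f g : RelevantElement 𝒜} {y : Spec (.of (Away 𝒜 f.val))}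
    {z : Spec (.of (Away 𝒜 g.val))} : Proj.ι f y = Proj.ι g z ↔
      ∃ (k : RelevantElement 𝒜) (hf : k ⟶ f) (hg : k ⟶ g) (w : (chartFunctor 𝒜).obj k),
        (chartFunctor 𝒜).map hf w = y ∧ (chartFunctor 𝒜).map hg w = z :=
  Scheme.IsLocallyDirected.ι_eq_ι_iff (chartFunctor 𝒜)

lemma Proj.map_ι {f g : RelevantElement 𝒜} (h : f ⟶ g) :
    (chartFunctor 𝒜).map h ≫ Proj.ι g = Proj.ι f :=
  colimit.w (chartFunctor 𝒜) h

/-- `t` is `h ^ N` times a unit; `N ≠ 0` excludes the trivial power. -/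
lemma IsFraction.notMem_iff {f h : S} {N : ℕ} (hN : N ≠ 0) {t : Away 𝒜 f}
    (ht : IsFraction 𝒜 f h N t) (p : PrimeSpectrum (Localization.Away f)) :
    t.val ∉ p.asIdeal ↔ algebraMap S _ h ∉ p.asIdeal := by
  obtain ⟨e, v, -, -, -, H⟩ := ht
  rw [H, not_iff_not, Ideal.mul_unit_mem_iff_mem _ v⁻¹.isUnit, map_pow,
    p.isPrime.pow_mem_iff_mem _ (Nat.pos_of_ne_zero hN)]

/-- Here `b = h / f ^ n`, so `t` and `b` are, up to units, powers of the same `h`. Any basic open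
`D(b)` of a chart is thereby of the form `D(t)`, which is again a chart. -/
lemma IsFraction.notMem_iff_of_mul_eq {f h : S} {N : ℕ} (hN : N ≠ 0) {t b : Away 𝒜 f}
    (ht : IsFraction 𝒜 f h N t) {n : ℕ} (hb : b.val * algebraMap S _ (f ^ n) = algebraMap S _ h)
    (p : PrimeSpectrum (Localization.Away f)) : t.val ∉ p.asIdeal ↔ b.val ∉ p.asIdeal := by
  rw [ht.notMem_iff hN, ← hb, not_iff_not, map_pow,
    Ideal.mul_unit_mem_iff_mem _ ((IsLocalization.Away.algebraMap_isUnit f).pow n)]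

lemma chartProjection_surjective (f : RelevantElement 𝒜) :
    Function.Surjective (chartProjection f) := by
  let := awayGradedRing f.isRelevant.homogeneous
  exact comap_surjective_of_gradeZero (ℬ := awayGrading 𝒜 f.val)
    (HomogeneousLocalization.val_injective _) (mem_awayGrading_zero_iff 𝒜)

lemma quotientMap_awayIncl_apply (f : RelevantElement 𝒜) (p : Spec (.of (Localization.Away f.val))) :
    quotientMap 𝒜 (awayIncl f p) = Proj.ι f (chartProjection f p) :=
  congr($(awayIncl_quotientMap f) p)

/-- The preimage of `D_+(f)` in `⋃ D(f)` is `D(f)`. -/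
lemma quotientMap_mem_range_ι_iff {f : RelevantElement 𝒜} {x : (quotientLocus 𝒜).toScheme} :
    quotientMap 𝒜 x ∈ Set.range (Proj.ι f) ↔ x ∈ Set.range (awayIncl f) := by
  refine ⟨fun ⟨z, hz⟩ => ?_, ?_⟩
  · obtain ⟨g, hg⟩ := mem_quotientLocus.mp x.2
    obtain ⟨p, rfl⟩ := mem_range_awayIncl.mpr hg
    rw [quotientMap_awayIncl_apply] at hz
    -- Points of two charts are identified only through a common smaller chart `D_+(k)`. Here `k = g
    -- a`, and the point of `D_+(g)` lies in `D_+(k)`, so `a`, hence `k`, does not vanish at `p`. As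
    -- `f` divides `k`, neither does `f`.
    obtain ⟨k, hkf, hkg, w, -, hw⟩ := Proj.ι_eq_ι_iff.mp hz
    obtain ⟨a, ha, hka⟩ := hkg.le
    obtain ⟨b, -, hkb⟩ := hkf.le
    obtain ⟨t, ht⟩ := g.isRelevant.exists_isFraction ha
    have htp : t.val ∉ p.asIdeal := by
      have : (chartFunctor 𝒜).map hkg w ∈ Set.range ((chartFunctor 𝒜).map hkg) := ⟨w, rfl⟩
      rw [range_chartFunctor_map hkg ha hka ht, hw] at this
      exact this
    replace htp := (ht.notMem_iff g.isRelevant.finiteIndex.index_ne_zero p).mp htp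
    rw [mem_range_awayIncl]
    have hx : (quotientLocus 𝒜).ι (awayIncl g p) =
        Spec.map (CommRingCat.ofHom (algebraMap S (Localization.Away g.val))) p :=
      congr($(awayIncl_ι g) p)
    rw [hx]
    change algebraMap S _ f.val ∉ p.asIdeal
    intro hf
    have h1 : algebraMap S (Localization.Away g.val) k.val ∈ p.asIdeal := by
      rw [hkb, map_mul]
      exact Ideal.mul_mem_right _ _ hf
    rw [hka, map_mul, Ideal.unit_mul_mem_iff_mem _ (IsLocalization.Away.algebraMap_isUnit _)] at h1
    exact htp h1
  · rintro ⟨p, rfl⟩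
    exact ⟨_, (quotientMap_awayIncl_apply f p).symm⟩

/-- The `D_+(f)` are a basis of the topology of `Proj^D(S)`. -/
lemma Proj.exists_range_ι_subset {V : (Proj 𝒜).Opens} {y : Proj 𝒜} (hy : y ∈ V) :
    ∃ g : RelevantElement 𝒜, y ∈ Set.range (Proj.ι g) ∧ (Proj.ι g).opensRange ≤ V := by
  obtain ⟨f, z, rfl⟩ := Proj.exists_ι_eq y
  obtain ⟨_, ⟨_, ⟨b, rfl⟩, rfl⟩, hzb, hbV⟩ := PrimeSpectrum.isBasis_basic_opens.exists_subset_of_mem_open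
    (show z ∈ ((Proj.ι f ⁻¹ᵁ V : (Spec (.of (Away 𝒜 f.val))).Opens) : Set _) from hy)
    (Proj.ι f ⁻¹ᵁ V).isOpen
  -- With `b = a / f ^ n`, the neighbourhood `D(b)` of `z` is the chart of `f a`.
  obtain ⟨n, i, a, -, ha, hab⟩ := isHomogeneousAway_val b
  obtain ⟨t, ht⟩ := f.isRelevant.exists_isFraction ⟨_, ha⟩
  have htb : (PrimeSpectrum.basicOpen t : Set (PrimeSpectrum (Away 𝒜 f.val))) =
      PrimeSpectrum.basicOpen b := by
    ext q
    obtain ⟨p, rfl⟩ := chartProjection_surjective f q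
    exact ht.notMem_iff_of_mul_eq f.isRelevant.finiteIndex.index_ne_zero hab p
  let g : RelevantElement 𝒜 := ⟨f.val * a, f.isRelevant.mul ⟨_, ha⟩⟩
  let h : g ⟶ f := homOfLE ⟨a, ⟨_, ha⟩, rfl⟩
  have hr := range_chartFunctor_map h ⟨_, ha⟩ rfl ht
  rw [htb] at hr
  refine ⟨g, ?_, ?_⟩
  · obtain ⟨w, hw⟩ : z ∈ Set.range ((chartFunctor 𝒜).map h) := by rw [hr]; exact hzb
    exact ⟨w, congr($(Proj.map_ι h) w).symm.trans (congrArg (Proj.ι f) hw)⟩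
  · rintro _ ⟨w, rfl⟩
    have hw : (chartFunctor 𝒜).map h w ∈ Set.range ((chartFunctor 𝒜).map h) := ⟨w, rfl⟩
    rw [hr] at hw
    have := hbV hw
    rw [← Proj.map_ι h]
    exact this

instance surjective_quotientMap : Surjective (quotientMap 𝒜) where
  surj y := by
    obtain ⟨f, z, rfl⟩ := Proj.exists_ι_eq y
    obtain ⟨p, rfl⟩ := chartProjection_surjective f z
    exact ⟨_, quotientMap_awayIncl_apply f p⟩

lemma isOpen_of_isOpen_preimage_quotientMap {V : Set (Proj 𝒜)}
    (hV : IsOpen (quotientMap 𝒜 ⁻¹' V)) : IsOpen V := by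
  have (f : RelevantElement 𝒜) : IsOpen (Proj.ι f ⁻¹' V) := by
    let := awayGradedRing f.isRelevant.homogeneous
    refine isOpen_of_isOpen_preimage_comap (ℬ := awayGrading 𝒜 f.val)
      (HomogeneousLocalization.val_injective _) (mem_awayGrading_zero_iff 𝒜) ?_
    have h : chartProjection f ⁻¹' (Proj.ι f ⁻¹' V) = awayIncl f ⁻¹' (quotientMap 𝒜 ⁻¹' V) :=
      Set.ext fun p => iff_of_eq (congrArg (· ∈ V) (quotientMap_awayIncl_apply f p)).symm
    exact (congrArg IsOpen h).mpr (hV.preimage (awayIncl f).continuous)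
  have hV' : V = ⋃ f : RelevantElement 𝒜, Proj.ι f '' (Proj.ι f ⁻¹' V) := by
    refine subset_antisymm (fun y hy => ?_) (Set.iUnion_subset fun f => Set.image_preimage_subset _ _)
    obtain ⟨f, z, rfl⟩ := Proj.exists_ι_eq y
    exact Set.mem_iUnion.mpr ⟨f, z, hy, rfl⟩
  rw [hV']
  exact isOpen_iUnion fun f => (Proj.ι f).isOpenEmbedding.isOpenMap _ (this f)

end
-- Invariance, and fibres as orbits
section

variable {S D : Type u} [CommRing S] [AddCommGroup D] [DecidableEq D]
  {𝒜 : D → AddSubgroup S} [GradedRing 𝒜]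

open HomogeneousLocalization

variable {R : Type u} [CommRing R] [Algebra R S] {ρ : S →+* AddMonoidAlgebra R D ⊗[R] S}
  (hρ : ∀ d, ∀ a ∈ 𝒜 d, ρ a = AddMonoidAlgebra.single d (1 : R) ⊗ₜ[R] a)

/-- The action of `Spec R[D]` on `D(f)`. -/
def awayAction (f : RelevantElement 𝒜) :
    Spec (.of (AddMonoidAlgebra R D ⊗[R] Localization.Away f.val)) ⟶
      Spec (.of (Localization.Away f.val)) :=
  Spec.map (CommRingCat.ofHom (coactionAway hρ f.isRelevant.homogeneous))

variable (R) in
/-- The projection of `Spec R[D] × D(f)` to `D(f)`. -/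
def awayProjection (f : RelevantElement 𝒜) :
    Spec (.of (AddMonoidAlgebra R D ⊗[R] Localization.Away f.val)) ⟶
      Spec (.of (Localization.Away f.val)) :=
  Spec.map (CommRingCat.ofHom (Algebra.TensorProduct.includeRight (R := R)
    (A := AddMonoidAlgebra R D) (B := Localization.Away f.val)).toRingHom)

lemma awayAction_chartProjection (f : RelevantElement 𝒜) :
    awayAction hρ f ≫ chartProjection f = awayProjection R f ≫ chartProjection f := by
  rw [awayAction, awayProjection, chartProjection, ← Spec.map_comp, ← Spec.map_comp,
    ← CommRingCat.ofHom_comp, ← CommRingCat.ofHom_comp]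
  congr 2
  ext t
  exact coactionAway_of_isHomogeneousAway hρ f.isRelevant.homogeneous (isHomogeneousAway_val t)

variable {T : Scheme.{u}} {a b : T ⟶ (quotientLocus 𝒜).toScheme}
  {k : ∀ f : RelevantElement 𝒜, Spec (.of (AddMonoidAlgebra R D ⊗[R] Localization.Away f.val)) ⟶ T}
  (ha : ∀ f, k f ≫ a = awayAction hρ f ≫ awayIncl f)
  (hb : ∀ f, k f ≫ b = awayProjection R f ≫ awayIncl f)

-- `T` stands for `G × U`, with `a` the action, `b` the projection and `k f` the chart `Spec R[D] ×
-- D(f)`. Equality is tested on these charts, where it says that `S_(f)` is coinvariant.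
include ha hb in
lemma comp_quotientMap_eq (hk' : ∀ f, IsOpenImmersion (k f)) (hk : ∀ z, ∃ f, z ∈ Set.range (k f)) :
    a ≫ quotientMap 𝒜 = b ≫ quotientMap 𝒜 := by
  let 𝒰 : T.OpenCover :=
    { I₀ := RelevantElement 𝒜
      X := fun f => Spec (.of (AddMonoidAlgebra R D ⊗[R] Localization.Away f.val))
      f := k
      mem₀ := by
        rw [Scheme.presieve₀_mem_precoverage_iff]
        exact ⟨hk, hk'⟩ }
  refine Scheme.Cover.hom_ext 𝒰 _ _ fun f => ?_
  change k f ≫ a ≫ quotientMap 𝒜 = k f ≫ b ≫ quotientMap 𝒜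
  rw [reassoc_of% ha f, reassoc_of% hb f, awayIncl_quotientMap,
    reassoc_of% awayAction_chartProjection hρ f]

include ha hb in
lemma exists_comp_eq_of_comp_quotientMap_eq {K : Type u} [Field K] [IsAlgClosed K]
    {x y : Spec (.of K) ⟶ (quotientLocus 𝒜).toScheme}
    (h : x ≫ quotientMap 𝒜 = y ≫ quotientMap 𝒜) :
    ∃ w : Spec (.of K) ⟶ T, w ≫ a = x ∧ w ≫ b = y := by
  let o : Spec (.of K) := (⊥ : PrimeSpectrum K)
  have ho (z : Spec (.of K)) : z = o := Subsingleton.elim (α := PrimeSpectrum K) z o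
  obtain ⟨f, hf⟩ := mem_quotientLocus.mp (x o).2
  have hx : Set.range x ⊆ Set.range (awayIncl f) := by
    rintro _ ⟨z, rfl⟩
    rw [ho z]
    exact mem_range_awayIncl.mpr hf
  -- The preimage of `D_+(f)` is `D(f)`, so `y` lies in the same chart as `x`.
  have hy : Set.range y ⊆ Set.range (awayIncl f) := by
    rintro _ ⟨z, rfl⟩
    rw [← quotientMap_mem_range_ι_iff, ← Scheme.Hom.comp_apply, ← h, Scheme.Hom.comp_apply,
      quotientMap_mem_range_ι_iff]
    exact hx ⟨z, rfl⟩
  obtain ⟨x', rfl⟩ : ∃ x', x' ≫ awayIncl f = x := ⟨_, IsOpenImmersion.lift_fac _ _ hx⟩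
  obtain ⟨y', rfl⟩ : ∃ y', y' ≫ awayIncl f = y := ⟨_, IsOpenImmersion.lift_fac _ _ hy⟩
  obtain ⟨φ, rfl⟩ := Spec.map_surjective x'
  obtain ⟨ψ, rfl⟩ := Spec.map_surjective y'
  simp only [Category.assoc, awayIncl_quotientMap] at h
  rw [← Category.assoc, ← Category.assoc, cancel_mono, chartProjection, ← Spec.map_comp,
    ← Spec.map_comp] at h
  -- The order is `ψ`, `φ`: the projection of the new point is `y`, and the action carries it to
  -- `x`.
  obtain ⟨r, hr, hr'⟩ := exists_ringHom_of_eq_on_away hρ f.isRelevant ψ.hom φ.hom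
    fun t => (congr($(Spec.map_injective h) t)).symm
  refine ⟨Spec.map (CommRingCat.ofHom r) ≫ k f, ?_, ?_⟩
  · rw [Category.assoc, ha, awayAction, ← Spec.map_comp_assoc, ← CommRingCat.ofHom_comp, hr]
    rfl
  · rw [Category.assoc, hb, awayProjection, ← Spec.map_comp_assoc, ← CommRingCat.ofHom_comp, hr']
    rfl

/-- Surjectivity can be tested on points with values in algebraically closed fields. -/
lemma surjective_of_exists_comp_eq {X Y : Scheme.{u}} (φ : X ⟶ Y)
    (h : ∀ (K : Type u) [Field K] [IsAlgClosed K] (y : Spec (.of K) ⟶ Y), ∃ x, x ≫ φ = y) :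
    Surjective φ where
  surj y := by
    let K := AlgebraicClosure (Y.residueField y)
    obtain ⟨x, hx⟩ := h K (Spec.map (CommRingCat.ofHom (algebraMap (Y.residueField y) K)) ≫
      Y.fromSpecResidueField y)
    let o : Spec (.of K) := (⊥ : PrimeSpectrum K)
    refine ⟨x o, ?_⟩
    rw [← Scheme.Hom.comp_apply, hx, Scheme.Hom.comp_apply, Scheme.fromSpecResidueField_apply]

include ha hb in
lemma surjective_pullback_lift (hab : a ≫ quotientMap 𝒜 = b ≫ quotientMap 𝒜) :
    Surjective (pullback.lift a b hab) := by
  refine surjective_of_exists_comp_eq _ fun K _ _ z => ?_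
  obtain ⟨w, hw, hw'⟩ := exists_comp_eq_of_comp_quotientMap_eq hρ ha hb
    (x := z ≫ pullback.fst _ _) (y := z ≫ pullback.snd _ _)
    (by rw [Category.assoc, Category.assoc, pullback.condition])
  exact ⟨w, pullback.hom_ext (by rw [Category.assoc, pullback.lift_fst, hw])
    (by rw [Category.assoc, pullback.lift_snd, hw'])⟩

end
-- The structure sheaf as the sheaf of invariants
section

lemma appLE_congr_hom_apply {X Y : Scheme.{u}} {f g : X ⟶ Y} (h : f = g) {W : Y.Opens} {V : X.Opens}
    (e : V ≤ f ⁻¹ᵁ W) (e' : V ≤ g ⁻¹ᵁ W) (s : Γ(Y, W)) : f.appLE W V e s = g.appLE W V e' s := by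
  subst h
  rfl

lemma app_apply_eq_appLE {X Y : Scheme.{u}} (f : X ⟶ Y) {V : Y.Opens} (s : Γ(Y, V)) :
    f.app V s = f.appLE V (f ⁻¹ᵁ V) le_rfl s := by
  rw [Scheme.Hom.app_eq_appLE]

/-- For an open immersion `j : A ⟶ B` with image `O`, `Γ(B, O) → Γ(A, ⊤)` is bijective. -/
lemma bijective_appLE_of_isOpenImmersion {A B : Scheme.{u}} (j : A ⟶ B) [IsOpenImmersion j]
    {O : B.Opens} (hO : O = j.opensRange) (e : ⊤ ≤ j ⁻¹ᵁ O) :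
    Function.Bijective (j.appLE O ⊤ e) := by
  have h1 : IsIso (j.app O) := j.isIso_app O hO.le
  have h2 : IsIso (A.presheaf.map (homOfLE e).op) := by
    have : IsIso (homOfLE e) := ⟨homOfLE le_top, rfl, rfl⟩
    infer_instance
  have : IsIso (j.appLE O ⊤ e) := inferInstanceAs (IsIso (j.app O ≫ A.presheaf.map (homOfLE e).op))
  exact ConcreteCategory.bijective_of_isIso (j.appLE O ⊤ e)

lemma ΓSpecIso_appLE_top {R R' : CommRingCat.{u}} (φ : R ⟶ R') (s : Γ(Spec R, ⊤)) :
    (Scheme.ΓSpecIso R').hom ((Spec.map φ).appLE ⊤ ⊤ le_rfl s) =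
      φ ((Scheme.ΓSpecIso R).hom s) := by
  have := congr($(Scheme.ΓSpecIso_naturality φ) s)
  rw [Scheme.Hom.appTop, Scheme.Hom.app_eq_appLE] at this
  exact this

variable {S D : Type u} [CommRing S] [AddCommGroup D] [DecidableEq D]
  {𝒜 : D → AddSubgroup S} [GradedRing 𝒜]

open HomogeneousLocalization

lemma injective_chartProjection_appLE (f : RelevantElement 𝒜) :
    Function.Injective ((chartProjection f).appLE ⊤ ⊤ le_rfl) := by
  intro s t h
  replace h := congrArg (Scheme.ΓSpecIso _).hom h
  rw [chartProjection, ΓSpecIso_appLE_top, ΓSpecIso_appLE_top] at h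
  exact (ConcreteCategory.bijective_of_isIso (Scheme.ΓSpecIso _).hom).injective
    (HomogeneousLocalization.val_injective _ h)

lemma top_le_preimage_opensRange {A B : Scheme.{u}} (j : A ⟶ B) [IsOpenImmersion j] {V : B.Opens}
    (h : j.opensRange ≤ V) : ⊤ ≤ j ⁻¹ᵁ V := fun x _ => h ⟨x, rfl⟩

lemma quotientMap_preimage_opensRange (f : RelevantElement 𝒜) :
    quotientMap 𝒜 ⁻¹ᵁ (Proj.ι f).opensRange = (awayIncl f).opensRange :=
  TopologicalSpace.Opens.ext (Set.ext fun _ => quotientMap_mem_range_ι_iff)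

lemma opensRange_awayIncl_le {f : RelevantElement 𝒜} {V : (Proj 𝒜).Opens}
    (h : (Proj.ι f).opensRange ≤ V) : (awayIncl f).opensRange ≤ quotientMap 𝒜 ⁻¹ᵁ V :=
  (quotientMap_preimage_opensRange f).ge.trans ((quotientMap 𝒜).preimage_mono h)

/-- Pullback of sections along the projection becomes, on each chart contained in `V`, the inclusion
`S_(f) ⊆ S_f`. -/
lemma awayIncl_appLE_quotientMap_app {f : RelevantElement 𝒜} {V : (Proj 𝒜).Opens}
    (h : (Proj.ι f).opensRange ≤ V) (r : Γ(Proj 𝒜, V)) :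
    (awayIncl f).appLE (quotientMap 𝒜 ⁻¹ᵁ V) ⊤
        (top_le_preimage_opensRange _ (opensRange_awayIncl_le h)) ((quotientMap 𝒜).app V r) =
      (chartProjection f).appLE ⊤ ⊤ le_rfl
        ((Proj.ι f).appLE V ⊤ (top_le_preimage_opensRange _ h) r) := by
  rw [app_apply_eq_appLE]
  refine (comp_appLE_apply _ _ _ _ r).trans (Eq.trans ?_ (comp_appLE_apply _ _ _ _ r).symm)
  exact appLE_congr_hom_apply (awayIncl_quotientMap f) _ _ r

lemma Proj.le_iSup_opensRange (V : (Proj 𝒜).Opens) :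
    V ≤ ⨆ g : {g : RelevantElement 𝒜 // (Proj.ι g).opensRange ≤ V}, (Proj.ι g.1).opensRange :=
  fun y hy => by
    obtain ⟨g, hg, hgV⟩ := Proj.exists_range_ι_subset hy
    exact TopologicalSpace.Opens.mem_iSup.mpr ⟨⟨g, hgV⟩, hg⟩

/-- Sections over `V ⊆ Proj^D(S)` are determined by their restrictions to the `D_+(f) ⊆ V`. -/
lemma Proj.section_ext {V : (Proj 𝒜).Opens} {s t : Γ(Proj 𝒜, V)}
    (h : ∀ (f : RelevantElement 𝒜) (hf : (Proj.ι f).opensRange ≤ V),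
      (Proj 𝒜).presheaf.map (homOfLE hf).op s = (Proj 𝒜).presheaf.map (homOfLE hf).op t) :
    s = t := by
  refine (Proj 𝒜).sheaf.eq_of_locally_eq' _ V
    (fun g => homOfLE g.2) (Proj.le_iSup_opensRange V) s t fun g => h g.1 g.2

lemma injective_quotientMap_app (V : (Proj 𝒜).Opens) :
    Function.Injective ((quotientMap 𝒜).app V) := by
  intro s t h
  refine Proj.section_ext fun f hf => ?_
  have hle := top_le_preimage_opensRange (Proj.ι f) le_rfl
  refine (bijective_appLE_of_isOpenImmersion (Proj.ι f) rfl hle).injective ?_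
  refine (appLE_map_apply _ hle (homOfLE hf).op s).trans
    (Eq.trans ?_ (appLE_map_apply _ hle (homOfLE hf).op t).symm)
  refine injective_chartProjection_appLE f ?_
  exact (awayIncl_appLE_quotientMap_app hf s).symm.trans
    ((congrArg _ h).trans (awayIncl_appLE_quotientMap_app hf t))

variable {R : Type u} [CommRing R] [Algebra R S] {ρ : S →+* AddMonoidAlgebra R D ⊗[R] S}
  (hρ : ∀ d, ∀ a ∈ 𝒜 d, ρ a = AddMonoidAlgebra.single d (1 : R) ⊗ₜ[R] a)

lemma exists_chartProjection_appLE_eq (f : RelevantElement 𝒜)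
    (s : Γ(Spec (.of (Localization.Away f.val)), ⊤))
    (hs : (awayAction hρ f).appLE ⊤ ⊤ le_rfl s = (awayProjection R f).appLE ⊤ ⊤ le_rfl s) :
    ∃ r, (chartProjection f).appLE ⊤ ⊤ le_rfl r = s := by
  replace hs := congrArg (Scheme.ΓSpecIso _).hom hs
  rw [awayAction, awayProjection, ΓSpecIso_appLE_top, ΓSpecIso_appLE_top] at hs
  obtain ⟨t, ht⟩ := mem_range_of_coactionAway_eq hρ f.isRelevant.homogeneous hs
  obtain ⟨r, hr⟩ := (ConcreteCategory.bijective_of_isIso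
    (Scheme.ΓSpecIso (.of (Away 𝒜 f.val))).hom).surjective t
  refine ⟨r, (ConcreteCategory.bijective_of_isIso (Scheme.ΓSpecIso _).hom).injective ?_⟩
  rw [chartProjection, ΓSpecIso_appLE_top, hr]
  exact ht

variable {T : Scheme.{u}} {a b : T ⟶ (quotientLocus 𝒜).toScheme}
  {k : ∀ f : RelevantElement 𝒜, Spec (.of (AddMonoidAlgebra R D ⊗[R] Localization.Away f.val)) ⟶ T}
  (ha : ∀ f, k f ≫ a = awayAction hρ f ≫ awayIncl f)
  (hb : ∀ f, k f ≫ b = awayProjection R f ≫ awayIncl f)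

include ha hb in
lemma exists_quotientMap_app_eq_on_chart {V : (Proj 𝒜).Opens} (s : Γ((quotientLocus 𝒜).toScheme, quotientMap 𝒜 ⁻¹ᵁ V))
    (hs : ∀ (W : T.Opens) (h₁ : W ≤ a ⁻¹ᵁ (quotientMap 𝒜 ⁻¹ᵁ V))
      (h₂ : W ≤ b ⁻¹ᵁ (quotientMap 𝒜 ⁻¹ᵁ V)),
      a.appLE (quotientMap 𝒜 ⁻¹ᵁ V) W h₁ s = b.appLE (quotientMap 𝒜 ⁻¹ᵁ V) W h₂ s)
    {f : RelevantElement 𝒜} (hf : (Proj.ι f).opensRange ≤ V) :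
    ∃ r : Γ(Proj 𝒜, (Proj.ι f).opensRange), (quotientMap 𝒜).app _ r =
      (quotientLocus 𝒜).toScheme.presheaf.map
        (homOfLE ((quotientMap 𝒜).preimage_mono hf)).op s := by
  have hV := top_le_preimage_opensRange _ (opensRange_awayIncl_le hf)
  -- The largest open on which both pullbacks of `s` are defined; it contains the chart `k f`, so
  -- invariance of `s` restricts to invariance under the coaction on `S_f`.
  let W : T.Opens := a ⁻¹ᵁ (quotientMap 𝒜 ⁻¹ᵁ V) ⊓ b ⁻¹ᵁ (quotientMap 𝒜 ⁻¹ᵁ V)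
  have hW : ⊤ ≤ k f ⁻¹ᵁ W := fun x _ => by
    constructor
    · change (k f ≫ a) x ∈ quotientMap 𝒜 ⁻¹ᵁ V
      rw [ha]
      exact hV (Set.mem_univ _)
    · change (k f ≫ b) x ∈ quotientMap 𝒜 ⁻¹ᵁ V
      rw [hb]
      exact hV (Set.mem_univ _)
  obtain ⟨r', hr'⟩ := exists_chartProjection_appLE_eq hρ f ((awayIncl f).appLE _ ⊤ hV s) (by
    have h := congrArg ((k f).appLE W ⊤ hW) (hs W inf_le_left inf_le_right)
    rw [comp_appLE_apply, comp_appLE_apply] at h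
    refine (comp_appLE_apply _ _ _ _ s).trans (((appLE_congr_hom_apply (ha f).symm _ _ s).trans
      h).trans ((appLE_congr_hom_apply (hb f) _ _ s).trans (comp_appLE_apply _ _ _ _ s).symm)))
  obtain ⟨r, hr⟩ := (bijective_appLE_of_isOpenImmersion (Proj.ι f) rfl
    (top_le_preimage_opensRange _ le_rfl)).surjective r'
  refine ⟨r, (bijective_appLE_of_isOpenImmersion (awayIncl f) (quotientMap_preimage_opensRange f)
    (top_le_preimage_opensRange _ (opensRange_awayIncl_le le_rfl))).injective ?_⟩
  rw [awayIncl_appLE_quotientMap_app le_rfl r, hr, hr']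
  exact (appLE_map_apply _ _ (homOfLE ((quotientMap 𝒜).preimage_mono hf)).op s).symm

include ha hb in
lemma mem_range_quotientMap_app_iff (hab : a ≫ quotientMap 𝒜 = b ≫ quotientMap 𝒜)
    (V : (Proj 𝒜).Opens) (s : Γ((quotientLocus 𝒜).toScheme, quotientMap 𝒜 ⁻¹ᵁ V)) :
    s ∈ Set.range ((quotientMap 𝒜).app V) ↔
      ∀ (W : T.Opens) (h₁ : W ≤ a ⁻¹ᵁ (quotientMap 𝒜 ⁻¹ᵁ V))
        (h₂ : W ≤ b ⁻¹ᵁ (quotientMap 𝒜 ⁻¹ᵁ V)),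
        a.appLE (quotientMap 𝒜 ⁻¹ᵁ V) W h₁ s = b.appLE (quotientMap 𝒜 ⁻¹ᵁ V) W h₂ s := by
  constructor
  · rintro ⟨r, rfl⟩ W h₁ h₂
    rw [app_apply_eq_appLE, comp_appLE_apply, comp_appLE_apply]
    exact appLE_congr_hom_apply hab _ _ r
  · intro hs
    let J := {g : RelevantElement 𝒜 // (Proj.ι g).opensRange ≤ V}
    let O (g : J) : (Proj 𝒜).Opens := (Proj.ι g.1).opensRange
    choose r hr using fun g : J => exists_quotientMap_app_eq_on_chart hρ ha hb s hs g.2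
    have hcov : V ≤ iSup O := Proj.le_iSup_opensRange V
    have hnat {V V' : (Proj 𝒜).Opens} (h : V ≤ V') (t : Γ(Proj 𝒜, V')) :
        (quotientMap 𝒜).app V ((Proj 𝒜).presheaf.map (homOfLE h).op t) =
          (quotientLocus 𝒜).toScheme.presheaf.map
            (homOfLE ((quotientMap 𝒜).preimage_mono h)).op ((quotientMap 𝒜).app V' t) :=
      congr($((quotientMap 𝒜).naturality (homOfLE h).op) t)
    have hres {V₁ V₂ V₃ : (quotientLocus 𝒜).toScheme.Opens} (h : V₁ ≤ V₂) (h' : V₂ ≤ V₃)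
        (t : Γ((quotientLocus 𝒜).toScheme, V₃)) : (quotientLocus 𝒜).toScheme.presheaf.map (homOfLE h).op
          ((quotientLocus 𝒜).toScheme.presheaf.map (homOfLE h').op t) =
        (quotientLocus 𝒜).toScheme.presheaf.map (homOfLE (h.trans h')).op t :=
      (congr($((quotientLocus 𝒜).toScheme.presheaf.map_comp (homOfLE h').op (homOfLE h).op) t)).symm
    obtain ⟨t, ht, -⟩ := (Proj 𝒜).sheaf.existsUnique_gluing' O V (fun g => homOfLE g.2) hcov r
      -- The local descents agree on overlaps because both pull back to the restriction of `s`, and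
      -- pullback is injective.
      (fun g g' => by
        refine injective_quotientMap_app _ ?_
        refine (hnat inf_le_left (r g)).trans (Eq.trans ?_ (hnat inf_le_right (r g')).symm)
        rw [hr, hr, hres, hres])
    refine ⟨t, ?_⟩
    refine (quotientLocus 𝒜).toScheme.sheaf.eq_of_locally_eq' (fun g : J => quotientMap 𝒜 ⁻¹ᵁ O g)
      _ (fun g => homOfLE ((quotientMap 𝒜).preimage_mono g.2)) (fun x hx => ?_) _ s fun g => ?_
    · obtain ⟨g, hg⟩ := TopologicalSpace.Opens.mem_iSup.mp (hcov hx)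
      exact TopologicalSpace.Opens.mem_iSup.mpr ⟨g, hg⟩
    · exact (hnat g.2 t).symm.trans ((congrArg _ (ht g)).trans (hr g))

end
-- The charts of `G × U`
section

variable {S D : Type u} [CommRing S] [AddCommGroup D] [DecidableEq D]
  {𝒜 : D → AddSubgroup S} [GradedRing 𝒜]

open HomogeneousLocalization

variable {R : Type u} [CommRing R] [Algebra R S] {ρ : S →+* AddMonoidAlgebra R D ⊗[R] S}
  (hρ : ∀ d, ∀ a ∈ 𝒜 d, ρ a = AddMonoidAlgebra.single d (1 : R) ⊗ₜ[R] a)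
  {T : Scheme.{u}} (e : T ≅ Spec (.of (AddMonoidAlgebra R D ⊗[R] S))) {a p : T ⟶ Spec (.of S)}
  (ha : a = e.hom ≫ Spec.map (CommRingCat.ofHom ρ))
  (hp : p = e.hom ≫ Spec.map (CommRingCat.ofHom (Algebra.TensorProduct.includeRight (R := R)
    (A := AddMonoidAlgebra R D) (B := S)).toRingHom))

-- `ρ f` is `1 ⊗ f` times the unit `χ^d ⊗ 1`, so the action preserves `D(f)`.
include hρ in
omit [DecidableEq D] [GradedRing 𝒜] in
lemma coaction_notMem_of_tmul_notMem {f : S} (hf : SetLike.IsHomogeneousElem 𝒜 f)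
    (P : PrimeSpectrum (AddMonoidAlgebra R D ⊗[R] S))
    (h : (1 : AddMonoidAlgebra R D) ⊗ₜ[R] f ∉ P.asIdeal) : ρ f ∉ P.asIdeal := by
  obtain ⟨d, hd⟩ := hf
  have : ρ f = (AddMonoidAlgebra.single d (1 : R) ⊗ₜ[R] (1 : S)) *
      ((1 : AddMonoidAlgebra R D) ⊗ₜ[R] f) := by
    rw [hρ d f hd, Algebra.TensorProduct.tmul_mul_tmul, mul_one, one_mul]
  rwa [this, Ideal.unit_mul_mem_iff_mem _ (isUnit_single_tmul_one R d)]

include hρ ha hp in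
/-- The open subset `⋃ D(f)` of `Spec S` is stable under `Spec R[D]`. -/
lemma preimage_quotientLocus_le : p ⁻¹ᵁ quotientLocus 𝒜 ≤ a ⁻¹ᵁ quotientLocus 𝒜 := by
  subst ha hp
  intro z hz
  obtain ⟨f, hf⟩ := mem_quotientLocus.mp hz
  exact mem_quotientLocus.mpr
    ⟨f, coaction_notMem_of_tmul_notMem hρ f.isRelevant.homogeneous (e.hom z) hf⟩

/-- The open immersion `Spec R[D] × D(f) ⟶ Spec R[D] × Spec S`. -/
def torusAway (f : RelevantElement 𝒜) :
    Spec (.of (AddMonoidAlgebra R D ⊗[R] Localization.Away f.val)) ⟶ T :=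
  Spec.map (CommRingCat.ofHom (tensorAwayMap D R f.val)) ≫ e.inv

instance (f : RelevantElement 𝒜) : IsOpenImmersion (torusAway e f) := by
  let := (tensorAwayMap D R f.val).toAlgebra
  have := isLocalization_tensorAwayMap (D := D) R f.val
  have : IsOpenImmersion (Spec.map (CommRingCat.ofHom (tensorAwayMap D R f.val))) :=
    IsOpenImmersion.of_isLocalization ((1 : AddMonoidAlgebra R D) ⊗ₜ[R] f.val)
  unfold torusAway
  infer_instance

lemma mem_range_torusAway (f : RelevantElement 𝒜) (z : T)
    (h : (1 : AddMonoidAlgebra R D) ⊗ₜ[R] f.val ∉ (e.hom z).asIdeal) :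
    z ∈ Set.range (torusAway e f) := by
  let := (tensorAwayMap D R f.val).toAlgebra
  have := isLocalization_tensorAwayMap (D := D) R f.val
  obtain ⟨w, hw⟩ : e.hom z ∈ Set.range (Spec.map (CommRingCat.ofHom (tensorAwayMap D R f.val))) :=
    (PrimeSpectrum.localization_away_comap_range _
      ((1 : AddMonoidAlgebra R D) ⊗ₜ[R] f.val)).ge h
  refine ⟨w, ?_⟩
  rw [torusAway, Scheme.Hom.comp_apply, hw, ← Scheme.Hom.comp_apply, e.hom_inv_id]
  rfl

include ha in
lemma torusAway_action (f : RelevantElement 𝒜) :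
    torusAway e f ≫ a = (awayAction hρ f ≫ awayIncl f) ≫ (quotientLocus 𝒜).ι := by
  rw [ha, torusAway, Category.assoc, e.inv_hom_id_assoc, Category.assoc, awayIncl_ι, awayAction,
    ← Spec.map_comp, ← Spec.map_comp, ← CommRingCat.ofHom_comp, ← CommRingCat.ofHom_comp]
  congr 2
  ext x
  exact (coactionAway_algebraMap hρ f.isRelevant.homogeneous x).symm

include hp in
lemma torusAway_projection (f : RelevantElement 𝒜) :
    torusAway e f ≫ p = (awayProjection R f ≫ awayIncl f) ≫ (quotientLocus 𝒜).ι := by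
  rw [hp, torusAway, Category.assoc, e.inv_hom_id_assoc, Category.assoc, awayIncl_ι,
    awayProjection, ← Spec.map_comp, ← Spec.map_comp, ← CommRingCat.ofHom_comp,
    ← CommRingCat.ofHom_comp]
  rfl

/-- The open immersion of `Spec R[D] × D(f)` in the part of `Spec R[D] × Spec S` over `⋃ D(f)`. -/
def torusAwayLift (f : RelevantElement 𝒜) :
    Spec (.of (AddMonoidAlgebra R D ⊗[R] Localization.Away f.val)) ⟶
      (p ⁻¹ᵁ quotientLocus 𝒜).toScheme :=
  IsOpenImmersion.lift (p ⁻¹ᵁ quotientLocus 𝒜).ι (torusAway e f) (by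
    rw [Scheme.Opens.range_ι]
    rintro _ ⟨z, rfl⟩
    change (torusAway e f ≫ p) z ∈ quotientLocus 𝒜
    rw [torusAway_projection e hp]
    exact ((awayProjection R f ≫ awayIncl f) z).2)

lemma torusAwayLift_ι (f : RelevantElement 𝒜) :
    torusAwayLift e hp f ≫ (p ⁻¹ᵁ quotientLocus 𝒜).ι = torusAway e f :=
  IsOpenImmersion.lift_fac _ _ _

instance isOpenImmersion_torusAwayLift (f : RelevantElement 𝒜) :
    IsOpenImmersion (torusAwayLift e hp f) := by
  have : IsOpenImmersion (torusAwayLift e hp f ≫ (p ⁻¹ᵁ quotientLocus 𝒜).ι) := by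
    rw [torusAwayLift_ι]
    infer_instance
  exact IsOpenImmersion.of_comp _ (p ⁻¹ᵁ quotientLocus 𝒜).ι

lemma exists_mem_range_torusAwayLift (z : (p ⁻¹ᵁ quotientLocus 𝒜).toScheme) :
    ∃ f, z ∈ Set.range (torusAwayLift e hp f) := by
  obtain ⟨f, hf⟩ := mem_quotientLocus.mp z.2
  obtain ⟨w, hw⟩ := mem_range_torusAway e f ((p ⁻¹ᵁ quotientLocus 𝒜).ι z) (by
    subst hp
    exact hf)
  refine ⟨f, w, (p ⁻¹ᵁ quotientLocus 𝒜).ι.isOpenEmbedding.injective ?_⟩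
  rw [← hw, ← torusAwayLift_ι e hp f, Scheme.Hom.comp_apply]

include ha in
lemma torusAwayLift_action (h : p ⁻¹ᵁ quotientLocus 𝒜 ≤ a ⁻¹ᵁ quotientLocus 𝒜)
    (f : RelevantElement 𝒜) : torusAwayLift e hp f ≫ a.resLE (quotientLocus 𝒜) _ h =
      awayAction hρ f ≫ awayIncl f := by
  rw [← cancel_mono (quotientLocus 𝒜).ι, Category.assoc, Scheme.Hom.resLE_comp_ι,
    ← Category.assoc, torusAwayLift_ι, torusAway_action hρ e ha]

lemma torusAwayLift_projection (f : RelevantElement 𝒜) :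
    torusAwayLift e hp f ≫ p.resLE (quotientLocus 𝒜) _ le_rfl =
      awayProjection R f ≫ awayIncl f := by
  rw [← cancel_mono (quotientLocus 𝒜).ι, Category.assoc, Scheme.Hom.resLE_comp_ι,
    ← Category.assoc, torusAwayLift_ι, torusAway_projection e hp]

end

/-! ### Assembly for the torus `Spec S_0[D]` -/

section

variable {S D : Type u} [CommRing S] [AddCommGroup D] [DecidableEq D]
  (𝒜 : D → AddSubgroup S) [GradedRing 𝒜]

lemma projection_torus_total : projection (torus 𝒜) (total 𝒜) =
    (pullbackSpecIso (𝒜 0) (AddMonoidAlgebra (𝒜 0) D) S).hom ≫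
      Spec.map (CommRingCat.ofHom (Algebra.TensorProduct.includeRight (R := 𝒜 0)
        (A := AddMonoidAlgebra (𝒜 0) D) (B := S)).toRingHom) :=
  (pullbackSpecIso_hom_snd (𝒜 0) (AddMonoidAlgebra (𝒜 0) D) S).symm

lemma isInvariantOpen_quotientLocus :
    IsInvariantOpen (torus 𝒜) (total 𝒜) (quotientLocus 𝒜) :=
  preimage_quotientLocus_le (R := 𝒜 0) (fun _ _ => coaction_of_mem 𝒜) _ (action_torus_total 𝒜)
    (projection_torus_total 𝒜)

/-- `Proj^D(S)` is the geometric quotient of `⋃ D(f)` by the torus. -/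
lemma isGeometricQuotient_quotientMap :
    IsGeometricQuotient (isInvariantOpen_quotientLocus 𝒜) (quotientMap 𝒜) := by
  have hp := projection_torus_total 𝒜
  have ha := torusAwayLift_action (𝒜 := 𝒜) (R := 𝒜 0) (fun _ _ => coaction_of_mem 𝒜) _
    (action_torus_total 𝒜) hp (isInvariantOpen_quotientLocus 𝒜)
  have hb := torusAwayLift_projection (𝒜 := 𝒜) (R := 𝒜 0) _ hp
  have hinv := comp_quotientMap_eq _ ha hb (isOpenImmersion_torusAwayLift _ hp)
    (exists_mem_range_torusAwayLift _ hp)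
  exact
    { invariant := hinv
      surjective := surjective_quotientMap
      orbits := surjective_pullback_lift _ ha hb hinv
      submersive := fun _ => isOpen_of_isOpen_preimage_quotientMap
      app_injective := injective_quotientMap_app
      mem_range_app_iff := mem_range_quotientMap_app_iff _ ha hb hinv }

lemma quotientLocus_carrier [AddGroup.FG D] :
    (quotientLocus 𝒜).carrier = geometricallySemistableLocus 𝒜 := by
  rw [geometricallySemistableLocus_eq]
  ext x
  refine mem_quotientLocus.trans (Iff.trans ?_ Set.mem_iUnion₂.symm)
  exact ⟨fun ⟨f, hf⟩ => ⟨f.val, f.isRelevant, hf⟩, fun ⟨f, h, hf⟩ => ⟨⟨f, h⟩, hf⟩⟩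

end
end DGraded
end

theorem mainTheorem1 {S D : Type u} [CommRing S] [AddCommGroup D] [AddGroup.FG D] [DecidableEq D]
    (𝒜 : D → AddSubgroup S) [GradedRing 𝒜] :
    DGraded.geometricallySemistableLocus 𝒜 =
        (⋃ f ∈ {f : S | DGraded.IsRelevant 𝒜 f}, (PrimeSpectrum.basicOpen f : Set (PrimeSpectrum S))) ∧
      (⋃ f ∈ {f : S | DGraded.IsRelevant 𝒜 f}, (PrimeSpectrum.basicOpen f : Set (PrimeSpectrum S))) =
        (PrimeSpectrum.zeroLocus (DGraded.irrelevantIdeal 𝒜 : Set S))ᶜ ∧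
      ∃ (U : (DGraded.total 𝒜).left.Opens)
        (hU : DGraded.IsInvariantOpen (DGraded.torus 𝒜) (DGraded.total 𝒜) U)
        (π : U.toScheme ⟶ DGraded.Proj 𝒜),
        U.carrier = DGraded.geometricallySemistableLocus 𝒜 ∧
        DGraded.IsCanonicalProjection 𝒜 U π ∧
        DGraded.IsGeometricQuotient hU π ∧
        ∀ (Y : Scheme.{u}) (φ : U.toScheme ⟶ Y),
          DGraded.IsGeometricQuotient hU φ → ∃! e : DGraded.Proj 𝒜 ≅ Y, π ≫ e.hom = φ :=
  ⟨DGraded.geometricallySemistableLocus_eq 𝒜, DGraded.iUnion_basicOpen_isRelevant_eq 𝒜,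
    DGraded.quotientLocus 𝒜, DGraded.isInvariantOpen_quotientLocus 𝒜, DGraded.quotientMap 𝒜,
    DGraded.quotientLocus_carrier 𝒜, DGraded.isCanonicalProjection_quotientMap,
    DGraded.isGeometricQuotient_quotientMap 𝒜,
    fun _ _ h => (DGraded.isGeometricQuotient_quotientMap 𝒜).existsUnique_iso h⟩
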